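/- Let $n\ge 1$, let $\Delta$ be the Laplacian of the standard metric on $S^n$, let $q'\ge 1$ be a real constant and let $f_1,f_2,f_3$ be real functions with $|f_1|+|f_2|+|f_3|\le B$ on $(0,\infty)$. Consider the system for $\alpha,\chi:(0,\infty)\times S^n\to\mathbb R$ $$\partial_\tau^2\alpha+\frac1\tau\partial_\tau\alpha+4q'\alpha-\frac{4}{(\tau^2+1)^2}\Delta\alpha=f_1(\tau)\,\tau\,\partial_\tau\alpha+f_2(\tau)\,\tau^2\alpha+f_3(\tau)\,\chi,\qquad \partial_\tau\chi=2\tau\alpha. \tag{1}$$ *Smooth solutions.* Let $\chi(0),\mathcal O,h\in C^\infty(S^n)$. A pair $\alpha,\chi\in C^\infty((0,\infty)\times S^n)$ solving (1) is a smooth solution with asymptotic data $(\chi(0),\mathcal O,h)$ if $\alpha-\mathcal O\log\tau-h$ and $\chi$ extend to elements of $C^1([0,\infty);C^\infty(S^n))$, the extension of $\chi$ has the value $\chi(0)$ at $\tau=0$, and, as $\tau\to0^+$, in $C^\infty(S^n)$ (that is, in every $C^k$ norm), $$\alpha=\mathcal O\log\tau+h+O(\tau^2|\log\tau|^2),\qquad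 \partial_\tau\alpha=\frac{\mathcal O}{\tau}+O(\tau|\log\tau|^2).$$ *Norms and multiplier.* Let $(\varphi_i)_{i\ge0}$ be an orthonormal basis of $L^2(S^n)$ of smooth eigenfunctions with frequencies $\lambda_i\ge0$, i.e. $-\Delta\varphi_i=\lambda_i^2\varphi_i$. For real $s\ge 0$ put $\|f\|_{H^s}^2=\sum_i(1+\lambda_i^2)^s\langle f,\varphi_i\rangle^2$. For $l\ge1$ put $f_l=\sum_{2^{l-1}<\lambda_i\le2^l}\langle f,\varphi_i\rangle\varphi_i$, and $$\mathfrak h=h-(\log\nabla)\mathcal O,\qquad (\log\nabla)\mathcal O=\sum_{l\ge1}l\log2\cdot\mathcal O_l .$$ **Theorem.** For every $s\ge1$ there is a constant $C$, depending only on $n,s,q',B$, such that for every smooth solution $(\alpha,\chi)$ of (1) with asymptotic data $(\chi(0),\mathcal O,h)$ the series defining $(\log\nabla)\mathcal O$ converges in $L^2(S^n)$ and $$\|\mathfrak h\|_{H^s}+\|\mathcal O\|_{H^s}\le C\Big(\|\alpha\|_{H^{s+1/2}}+\|\partial_\tau\alpha\|_{H^{s-1/2}}+\|\chi\|_{H^{s-1/2}}\Big)\Big|_{\tau=1},$$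 $$\|\chi(0)\|_{H^{s+1/2}}\le C\Big(\|\alpha\|_{H^{s+1/2}}+\|\partial_\tau\alpha\|_{H^{s-1/2}}+\|\chi\|_{H^{s+1/2}}\Big)\Big|_{\tau=1}.$$ -/

import Mathlib

open MeasureTheory Set Filter
open scoped Topology NNReal ENNReal Manifold ContDiff

noncomputable section

namespace ModelScattering

/-- The round unit sphere `S^n` in `ℝ^(n+1)`, with Mathlib's smooth structure. -/
abbrev Sphere (n : ℕ) : Type := Metric.sphere (0 : EuclideanSpace ℝ (Fin (n + 1))) 1

/-- The surface measure of `S^n`. -/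
def surfaceMeasure (n : ℕ) : Measure (Sphere n) :=
  (volume : Measure (EuclideanSpace ℝ (Fin (n + 1)))).toSphere

/-- The Hilbert space `L^2(S^n)` of real-valued functions. -/
abbrev L2 (n : ℕ) : Type := Lp ℝ 2 (surfaceMeasure n)

/-- `f ∈ C^∞(S^n)`. -/
def SmoothOnSphere {n : ℕ} (f : Sphere n → ℝ) : Prop :=
  ContMDiff (𝓡 n) 𝓘(ℝ, ℝ) ∞ f

open Classical in
/-- The class in `L^2(S^n)` of a square integrable function
(every smooth function is square integrable). -/
def toL2 {n : ℕ} (f : Sphere n → ℝ) : L2 n :=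
  if hf : MemLp f 2 (surfaceMeasure n) then hf.toLp f else 0

/-- The normalization `y ↦ y / |y|` of nonzero vectors. -/
def radialProj {n : ℕ} (y : EuclideanSpace ℝ (Fin (n + 1))) (hy : y ≠ 0) : Sphere n :=
  ⟨(‖y‖)⁻¹ • y, by simp [norm_smul, hy]⟩

open Classical in
/-- The extension of `f` to `ℝ^(n+1) \ {0}` which is homogeneous of degree zero,
`y ↦ f (y / |y|)`. -/
def radialExt {n : ℕ} (f : Sphere n → ℝ) (y : EuclideanSpace ℝ (Fin (n + 1))) : ℝ :=
  if hy : y = 0 then 0 else f (radialProj y hy)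

/-- The Laplacian of the standard metric on `S^n`: the restriction to the sphere of the Euclidean
Laplacian of the extension which is constant along rays
(in polar coordinates `Δ = ∂_r² + (n/r) ∂_r + r⁻² Δ_{S^n}`). -/
def sphereLaplacian {n : ℕ} (f : Sphere n → ℝ) (x : Sphere n) : ℝ :=
  Laplacian.laplacian (radialExt f) (x : EuclideanSpace ℝ (Fin (n + 1)))

/-! ### Frequency decomposition and Sobolev norms -/

/-- `φ` is a smooth eigenfunction of frequency `lam ≥ 0`, that is `-Δ φ = lam² φ`. -/
def IsEigenfunction {n : ℕ} (lam : ℝ≥0) (φ : Sphere n → ℝ) : Prop :=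
  SmoothOnSphere φ ∧ ∀ x, -sphereLaplacian φ x = (lam : ℝ) ^ 2 * φ x

/-- The closed subspace of `L^2(S^n)` spanned by the eigenfunctions with frequency in `I`. -/
def spectralSubspace (n : ℕ) (I : Set ℝ≥0) : Submodule ℝ (L2 n) :=
  (Submodule.span ℝ
    {g : L2 n | ∃ lam ∈ I, ∃ φ : Sphere n → ℝ, IsEigenfunction lam φ ∧ g = toL2 φ}).topologicalClosure

instance (n : ℕ) (I : Set ℝ≥0) : CompleteSpace (spectralSubspace n I) :=
  Submodule.topologicalClosure.completeSpace _

/-- The frequency projection `P_I`: for an orthonormal basis of eigenfunctions `φ_i` of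
frequencies `lam_i` this is `P_I f = ∑_{lam_i ∈ I} ⟨f, φ_i⟩ φ_i`. -/
def freqProj (n : ℕ) (I : Set ℝ≥0) : L2 n →L[ℝ] L2 n :=
  (spectralSubspace n I).starProjection

/-- The norm of `H^s(S^n)`, with value `∞` outside `H^s`:
`‖f‖² = ∑_lam (1 + lam²)^s ‖P_{lam} f‖²`, the sum being over all frequencies `lam`. Grouping
equal frequencies, this is `∑_i (1 + lam_i²)^s ⟨f, φ_i⟩²` for an orthonormal basis of
eigenfunctions (`P_{lam} = 0` unless `lam²` is an eigenvalue of `-Δ`). -/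
def sobolevNorm {n : ℕ} (s : ℝ) (f : L2 n) : ℝ≥0∞ :=
  (∑' lam : ℝ≥0, ENNReal.ofReal ((1 + (lam : ℝ) ^ 2) ^ s) *
    ‖freqProj n {lam} f‖ₑ ^ 2) ^ (1 / 2 : ℝ)

/-- The dyadic frequency bands `[0, 1]` and `(2^(l-1), 2^l]` for `l ≥ 1`. -/
def band : ℕ → Set ℝ≥0
  | 0 => Iic 1
  | l + 1 => Ioc (2 ^ l) (2 ^ (l + 1))

/-- The terms `l log 2 · f_l` of the series `(log ∇) f = ∑_{l ≥ 1} l log 2 · f_l`, where `f_l` is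
the projection of `f` to the `l`-th band (the term `l = 0` vanishes). -/
def logGradTerm {n : ℕ} (f : L2 n) (l : ℕ) : L2 n :=
  ((l : ℝ) * Real.log 2) • freqProj n (band l) f

/-- The Fourier multiplier `log ∇`, for `f` such that its series converges. -/
def logGrad {n : ℕ} (f : L2 n) : L2 n := ∑' l : ℕ, logGradTerm f l

/-! ### Time dependent families in the Fréchet space `C^∞(S^n)`

The topology of `C^∞(S^n)` is given by the seminorms
`sup_{x ∈ S^n} |D^k F (x)|`, `k = 0, 1, …`, where `F` is the radially constant extension. -/

/-- `u σ → v` in `C^∞(S^n)` along the filter `l`. -/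
def TendstoSmooth {n : ℕ} (u : ℝ → Sphere n → ℝ) (l : Filter ℝ) (v : Sphere n → ℝ) : Prop :=
  ∀ k : ℕ, TendstoUniformlyOn
    (fun σ y => iteratedFDeriv ℝ k (radialExt (u σ)) y)
    (fun y => iteratedFDeriv ℝ k (radialExt v) y) l
    (Metric.sphere (0 : EuclideanSpace ℝ (Fin (n + 1))) 1)

/-- `u ∈ C^0([0,∞); C^∞(S^n))`. -/
def ContinuousInSmooth {n : ℕ} (u : ℝ → Sphere n → ℝ) : Prop :=
  ∀ τ ∈ Ici (0 : ℝ), SmoothOnSphere (u τ) ∧ TendstoSmooth u (𝓝[Ici 0] τ) (u τ)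

/-- `u ∈ C^1([0,∞); C^∞(S^n))`. -/
def C1InSmooth {n : ℕ} (u : ℝ → Sphere n → ℝ) : Prop :=
  ContinuousInSmooth u ∧
    ∃ u' : ℝ → Sphere n → ℝ, ContinuousInSmooth u' ∧
      ∀ τ ∈ Ici (0 : ℝ),
        TendstoSmooth (fun σ x => (u σ x - u τ x) / (σ - τ)) (𝓝[Ici 0 \ {τ}] τ) (u' τ)

/-- `u(τ) = O(g(τ))` in `C^∞(S^n)` as `τ → 0⁺`. -/
def IsBigOInSmooth {n : ℕ} (u : ℝ → Sphere n → ℝ) (g : ℝ → ℝ) : Prop :=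
  ∀ k : ℕ, ∃ C : ℝ, ∀ᶠ τ in 𝓝[>] (0 : ℝ), ∀ x : Sphere n,
    ‖iteratedFDeriv ℝ k (radialExt (u τ)) (x : EuclideanSpace ℝ (Fin (n + 1)))‖ ≤ C * |g τ|

/-! ### The model system -/

/-- The time derivative `∂_τ u`. -/
def timeDeriv {n : ℕ} (u : ℝ → Sphere n → ℝ) (τ : ℝ) (x : Sphere n) : ℝ :=
  deriv (fun σ => u σ x) τ

/-- `u ∈ C^∞((0,∞) × S^n)`. -/
def SmoothOnPositiveTimes {n : ℕ} (u : ℝ → Sphere n → ℝ) : Prop :=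
  ContMDiffOn (𝓘(ℝ, ℝ).prod (𝓡 n)) 𝓘(ℝ, ℝ) ∞ (fun p : ℝ × Sphere n => u p.1 p.2)
    (Ioi (0 : ℝ) ×ˢ univ)

/-- `(α, χ)` is a smooth solution, on `(0,∞) × S^n`, of the model system with coefficients
`q', f₁, f₂, f₃`, with asymptotic data `(χ₀, 𝒪, h)` at `τ = 0`. -/
structure IsSmoothSolution {n : ℕ} (q' : ℝ) (f₁ f₂ f₃ : ℝ → ℝ) (α χ : ℝ → Sphere n → ℝ)
    (χ₀ O h : Sphere n → ℝ) : Prop where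
  smooth_chi_zero : SmoothOnSphere χ₀
  smooth_O : SmoothOnSphere O
  smooth_h : SmoothOnSphere h
  smooth_alpha : SmoothOnPositiveTimes α
  smooth_chi : SmoothOnPositiveTimes χ
  alpha_eq : ∀ τ > 0, ∀ x,
    timeDeriv (timeDeriv α) τ x + 1 / τ * timeDeriv α τ x + 4 * q' * α τ x
        - 4 / (τ ^ 2 + 1) ^ 2 * sphereLaplacian (α τ) x
      = f₁ τ * τ * timeDeriv α τ x + f₂ τ * τ ^ 2 * α τ x + f₃ τ * χ τ x
  chi_eq : ∀ τ > 0, ∀ x, timeDeriv χ τ x = 2 * τ * α τ x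
  /-- `α - 𝒪 log τ - h` extends to an element of `C^1([0,∞); C^∞(S^n))`. -/
  alpha_regular : ∃ w : ℝ → Sphere n → ℝ, C1InSmooth w ∧
    ∀ τ > 0, ∀ x, w τ x = α τ x - O x * Real.log τ - h x
  /-- `χ` extends to an element of `C^1([0,∞); C^∞(S^n))` with value `χ₀` at `τ = 0`. -/
  chi_regular : ∃ w : ℝ → Sphere n → ℝ, C1InSmooth w ∧
    (∀ τ > 0, ∀ x, w τ x = χ τ x) ∧ ∀ x, w 0 x = χ₀ x
  alpha_expansion : IsBigOInSmooth
    (fun τ x => α τ x - (O x * Real.log τ + h x)) (fun τ => τ ^ 2 * |Real.log τ| ^ 2)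
  deriv_alpha_expansion : IsBigOInSmooth
    (fun τ x => timeDeriv α τ x - O x / τ) (fun τ => τ * |Real.log τ| ^ 2)

end ModelScattering

end

/-! Pairing a solution with an eigenfunction of frequency `lam` gives a scalar singular ODE. The
theorem follows from estimates for it that are uniform in `lam`, because the Sobolev norms are sums
over frequencies. Write `μ = √(1 + lam²)`; the mode changes character at `τ = 1/μ`.

On `[1/μ, 1]` the mode oscillates. For `b = √τ a` the energy is `b'² + W b² + x²` with `W ≥ μ²`.
Removing the damping `a'/τ` costs the relative error `1/(4μτ²)`, whose integral over the region is
at most `1/4`, so Grönwall is uniform in `μ` (`IsModeSolution.modeEnergy_le`).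

On `(0, 1/μ]` the mode behaves like `o log τ + h`. The variables `p = τ a'` and `g = a - p log (μ
τ)` are nearly constant: with `s = μτ`, the Grönwall factor is a constant times the integral of `s
(1 - log s)²` over `(0, 1)`, again independent of `μ` (`IsModeSolution.modeInnerEnergy_le`). At `τ =
1/μ` the logarithm vanishes, and the inner energy is at most `5/μ` times the outer one. The factor
`1/μ` is the shift by half a derivative.

As `τ → 0`, `p` tends to `o` and `g` to `h - o log μ`. On the `l`-th dyadic band `log μ` differs
from `l log 2` by at most one, so up to a multiple of `o` the second limit is the component of `𝔥`.
For `χ(0)`, the equation `x' = 2τa` is integrated from time one, with `|τ a|` gaining a factor `1/μ`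
(`IsModeSolution.asymptotic_data_le`).

The passage to modes needs symmetry of the spherical Laplacian, obtained from the Euclidean
divergence theorem in an annulus. Each frequency projection is then estimated by duality against
eigenfunctions, so neither the spectrum nor completeness of the eigenfunctions enters. -/

namespace ModelScattering

/-! ### Uniform estimates for a single mode -/

/-- The scalar system satisfied by the coefficients of a solution along an eigenfunction of
frequency `lam`; the lower order terms are collected in the forcing `r`. -/
structure IsModeSolution (q' B lam : ℝ) (a a₁ x : ℝ → ℝ) : Prop where
  deriv_a : ∀ τ > 0, HasDerivAt a (a₁ τ) τ
  deriv_x : ∀ τ > 0, HasDerivAt x (2 * τ * a τ) τ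
  deriv_a₁ : ∀ τ > 0, ∃ r : ℝ, |r| ≤ B * (τ * |a₁ τ| + τ ^ 2 * |a τ| + |x τ|) ∧
    HasDerivAt a₁ (r - a₁ τ / τ - 4 * q' * a τ - 4 * lam ^ 2 / (τ ^ 2 + 1) ^ 2 * a τ) τ

/-- Grönwall's inequality backwards in time: the hypothesis makes `E * exp K` nondecreasing, so the
earlier energy is bounded by the later one. -/
theorem mul_exp_le_of_neg_mul_le_deriv {E E' K k : ℝ → ℝ} {b c : ℝ} (hbc : b ≤ c)
    (hE : ∀ τ ∈ Icc b c, HasDerivAt E (E' τ) τ) (hK : ∀ τ ∈ Icc b c, HasDerivAt K (k τ) τ)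
    (h : ∀ τ ∈ Icc b c, -(k τ * E τ) ≤ E' τ) :
    E b * Real.exp (K b) ≤ E c * Real.exp (K c) := by
  have hd : ∀ τ ∈ Icc b c, HasDerivAt (fun τ => E τ * Real.exp (K τ))
      (E' τ * Real.exp (K τ) + E τ * (Real.exp (K τ) * k τ)) τ := fun τ hτ =>
    (hE τ hτ).mul (hK τ hτ).exp
  have hm : MonotoneOn (fun τ => E τ * Real.exp (K τ)) (Icc b c) := by
    apply monotoneOn_of_deriv_nonneg (convex_Icc b c)
    · exact fun τ hτ => (hd τ hτ).continuousAt.continuousWithinAt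
    · exact fun τ hτ => (hd τ (interior_subset hτ)).differentiableAt.differentiableWithinAt
    · intro τ hτ
      rw [(hd τ (interior_subset hτ)).deriv]
      have := h τ (interior_subset hτ)
      nlinarith [Real.exp_pos (K τ)]
  exact hm (left_mem_Icc.2 hbc) (right_mem_Icc.2 hbc) hbc

/-- The potential of the mode of frequency `lam`, with the mass normalized. -/
noncomputable def modePotential (lam τ : ℝ) : ℝ := 4 * lam ^ 2 / (τ ^ 2 + 1) ^ 2 + 4

/-- The energy controlling a mode in the oscillatory region. -/
noncomputable def modeEnergy (lam : ℝ) (a a₁ x : ℝ → ℝ) (τ : ℝ) : ℝ :=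
  τ * (a₁ τ + a τ / (2 * τ)) ^ 2 + τ * (modePotential lam τ * a τ ^ 2) + x τ ^ 2

/-- For `τ ≤ 1` the factor `(τ² + 1)²` is at most `4`. The bound is used in the form `μ² ≤ W`. -/
theorem le_modePotential (lam : ℝ) {τ : ℝ} (h0 : 0 ≤ τ) (h1 : τ ≤ 1) :
    lam ^ 2 + 4 ≤ modePotential lam τ := by
  have h : (τ ^ 2 + 1) ^ 2 ≤ 4 := by
    have : τ ^ 2 ≤ 1 := by nlinarith
    nlinarith [sq_nonneg τ]
  have : lam ^ 2 ≤ 4 * lam ^ 2 / (τ ^ 2 + 1) ^ 2 := by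
    rw [le_div_iff₀ (by positivity)]
    nlinarith [sq_nonneg lam]
  unfold modePotential; linarith

theorem hasDerivAt_modePotential (lam τ : ℝ) :
    HasDerivAt (modePotential lam) (-(16 * lam ^ 2 * τ / (τ ^ 2 + 1) ^ 3)) τ := by
  have h1 : HasDerivAt (fun τ : ℝ => (τ ^ 2 + 1) ^ 2) (2 * (τ ^ 2 + 1) * (2 * τ)) τ := by
    convert! (((hasDerivAt_id τ).pow 2).add_const 1).pow 2 using 1
    simp
  have h0 : (τ ^ 2 + 1) ≠ 0 := by positivity
  convert! ((hasDerivAt_const τ (4 * lam ^ 2)).div h1 (by positivity)).add_const 4 using 1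
  field_simp
  ring

theorem abs_mul_le_half_add (p q : ℝ) : |p| * |q| ≤ (p ^ 2 + q ^ 2) / 2 := by
  nlinarith [sq_nonneg (|p| - |q|), sq_abs p, sq_abs q]

variable {q' B lam : ℝ} {a a₁ x : ℝ → ℝ}

-- With `b = √τ a` one has `b' = √τ u`, and the energy is `b'² + W b² + x²`. The only singular term
-- left in its derivative is `u A / (2τ)`. Since `W ≥ μ²`, it is at most the energy divided by
-- `4μτ²`. The remaining terms cost a constant: `16` for the derivative of the potential, `2` for
-- the equation of `x`, and the rest for the forcing.
set_option maxHeartbeats 400000 in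
theorem IsModeSolution.deriv_modeEnergy (hs : IsModeSolution q' B lam a a₁ x) (hB : 0 ≤ B)
    {τ μ : ℝ} (hμ : 1 ≤ μ) (hμl : μ ^ 2 = 1 + lam ^ 2) (hτ0 : 0 < τ) (hτ1 : τ ≤ 1) :
    ∃ E' : ℝ, HasDerivAt (modeEnergy lam a a₁ x) E' τ ∧
      -((5 * B + 4 * |1 - q'| + 18 + 1 / (4 * μ * τ ^ 2)) * modeEnergy lam a a₁ x τ) ≤ E' := by
  obtain ⟨r, hr, ha₁⟩ := hs.deriv_a₁ τ hτ0
  have ha := hs.deriv_a τ hτ0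
  have hx := hs.deriv_x τ hτ0
  set u : ℝ := a₁ τ + a τ / (2 * τ) with hu
  set W := modePotential lam τ with hW
  have hWd : W = 4 * lam ^ 2 / (τ ^ 2 + 1) ^ 2 + 4 := rfl
  have hWl : lam ^ 2 + 4 ≤ W := le_modePotential lam hτ0.le hτ1
  have h2τ : HasDerivAt (fun τ : ℝ => 2 * τ) 2 τ := by
    simpa using (hasDerivAt_id τ).const_mul 2
  set A := a τ with hA
  set X := x τ with hX
  have hτne := hτ0.ne'
  -- The mass `4q'` is traded for the `4` contained in `W`; the difference `4 (1 - q') A` joins the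
  -- forcing.
  have hud : HasDerivAt (fun σ => a₁ σ + a σ / (2 * σ))
      (r + 4 * (1 - q') * A - W * A - u / (2 * τ) - A / (4 * τ ^ 2)) τ := by
    convert! ha₁.add (ha.div h2τ (by positivity)) using 1
    rw [hu, hWd]
    field_simp
    ring
  have hEd := (((hasDerivAt_id' τ).mul (hud.pow 2)).add ((hasDerivAt_id' τ).mul
    ((hasDerivAt_modePotential lam τ).mul (ha.pow 2)))).add (hx.pow 2)
  have key : HasDerivAt (modeEnergy lam a a₁ x)
      (-(u * A / (2 * τ)) - τ * (16 * lam ^ 2 * τ / (τ ^ 2 + 1) ^ 3) * A ^ 2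
        + 2 * τ * u * (r + 4 * (1 - q') * A) + 4 * τ * A * X) τ := by
    convert! hEd using 1
    have ha₁u : a₁ τ = u - A / (2 * τ) := by rw [hu]; ring
    simp only [Pi.pow_apply, Pi.mul_apply, ← hA, ← hW, ← hu]
    rw [ha₁u]
    generalize 16 * lam ^ 2 * τ / (τ ^ 2 + 1) ^ 3 = V
    push_cast
    field_simp
    ring
  refine ⟨_, key, ?_⟩
  have hE : modeEnergy lam a a₁ x τ = τ * u ^ 2 + τ * (W * A ^ 2) + X ^ 2 := rfl
  have hμ0 : 0 < μ := by linarith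
  have hAW : A ^ 2 ≤ W * A ^ 2 := by nlinarith [sq_nonneg A, sq_nonneg lam]
  have t1 : u * A / (2 * τ) ≤ 1 / (4 * μ * τ ^ 2) * modeEnergy lam a a₁ x τ := by
    have h1 : u * A * (2 * μ) ≤ u ^ 2 + W * A ^ 2 := by
      nlinarith [sq_nonneg (u - μ * A), sq_nonneg A]
    have h2 : u * A * (2 * μ) * τ ≤ modeEnergy lam a a₁ x τ := by
      rw [hE]; nlinarith [sq_nonneg X]
    have h3 : u * A / (2 * τ) = 1 / (4 * μ * τ ^ 2) * (u * A * (2 * μ) * τ) := by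
      field_simp; ring
    rw [h3]
    gcongr
  have t2 : τ * (16 * lam ^ 2 * τ / (τ ^ 2 + 1) ^ 3) * A ^ 2 ≤ 16 * modeEnergy lam a a₁ x τ := by
    have h1 : lam ^ 2 * τ / (τ ^ 2 + 1) ^ 3 ≤ W := by
      rw [div_le_iff₀ (by positivity)]
      have : 1 ≤ (τ ^ 2 + 1) ^ 3 := one_le_pow₀ (by nlinarith)
      nlinarith [sq_nonneg lam]
    have h2 : τ * A ^ 2 * (lam ^ 2 * τ / (τ ^ 2 + 1) ^ 3) ≤ τ * A ^ 2 * W := by gcongr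
    rw [hE]
    have h4 : 16 * lam ^ 2 * τ / (τ ^ 2 + 1) ^ 3 = 16 * (lam ^ 2 * τ / (τ ^ 2 + 1) ^ 3) := by ring
    rw [h4]
    nlinarith [sq_nonneg X, mul_nonneg hτ0.le (sq_nonneg u)]
  have hR : |r + 4 * (1 - q') * A| ≤ B * (|u| + 2 * |A| + |X|) + 4 * |1 - q'| * |A| := by
    have h1 : τ * |a₁ τ| ≤ |u| + |A| := by
      have : τ * a₁ τ = τ * u - A / 2 := by rw [hu]; field_simp; ring
      rw [← abs_of_pos hτ0, ← abs_mul, abs_of_pos hτ0, this]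
      refine (abs_sub _ _).trans ?_
      rw [abs_mul, abs_div, abs_of_pos hτ0, abs_two]
      nlinarith [abs_nonneg u, abs_nonneg A]
    have h2 : τ ^ 2 * |A| ≤ |A| := by
      nlinarith [abs_nonneg A, (by nlinarith : τ ^ 2 ≤ 1)]
    refine (abs_add_le _ _).trans (add_le_add (hr.trans ?_) ?_)
    · exact mul_le_mul_of_nonneg_left (by linarith) hB
    · rw [abs_mul, abs_mul, abs_of_pos (by norm_num : (0 : ℝ) < 4)]
  have t3 : -(2 * τ * u * (r + 4 * (1 - q') * A)) ≤
      (5 * B + 4 * |1 - q'|) * modeEnergy lam a a₁ x τ := by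
    set D := 4 * |1 - q'| with hD
    have hD0 : 0 ≤ D := by positivity
    calc -(2 * τ * u * (r + 4 * (1 - q') * A)) ≤ |2 * τ * u * (r + 4 * (1 - q') * A)| :=
          neg_le_abs _
      _ = 2 * τ * (|u| * |r + 4 * (1 - q') * A|) := by
          rw [abs_mul, abs_mul, abs_of_pos (by positivity : 0 < 2 * τ)]; ring
      _ ≤ 2 * τ * (|u| * (B * (|u| + 2 * |A| + |X|) + D * |A|)) := by gcongr
      _ = τ * (2 * B * u ^ 2 + (2 * B + D) * (2 * (|u| * |A|)))
            + B * (2 * τ * (|u| * |X|)) := by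
          rw [← sq_abs u]; ring
      _ ≤ τ * (2 * B * u ^ 2 + (2 * B + D) * (u ^ 2 + W * A ^ 2)) + B * (τ * u ^ 2 + X ^ 2) := by
          have h1 := abs_mul_le_half_add u A
          have h2 := abs_mul_le_half_add u X
          have h3 : τ * (|u| * |X|) ≤ τ * ((u ^ 2 + X ^ 2) / 2) := by gcongr
          have h4 : τ * X ^ 2 ≤ X ^ 2 := by nlinarith [sq_nonneg X]
          gcongr
          · linarith
          · linarith
      _ ≤ (5 * B + D) * modeEnergy lam a a₁ x τ := by
          rw [hE]
          linarith [mul_nonneg hB (sq_nonneg X), mul_nonneg hD0 (sq_nonneg X),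
            mul_nonneg hB (mul_nonneg hτ0.le ((sq_nonneg A).trans hAW))]
  have t4 : -(4 * τ * A * X) ≤ 2 * modeEnergy lam a a₁ x τ := by
    rw [hE]
    have h4 : τ * X ^ 2 ≤ X ^ 2 := by nlinarith [sq_nonneg X]
    nlinarith [mul_nonneg hτ0.le (sq_nonneg (A + X)), mul_nonneg hτ0.le (sq_nonneg u),
      mul_le_mul_of_nonneg_left hAW hτ0.le]
  linarith

/-- The energy in the oscillatory region is controlled by the energy at time one. -/
theorem IsModeSolution.modeEnergy_le (hs : IsModeSolution q' B lam a a₁ x) (hB : 0 ≤ B)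
    {τ μ : ℝ} (hμ : 1 ≤ μ) (hμl : μ ^ 2 = 1 + lam ^ 2) (hτ0 : μ⁻¹ ≤ τ) (hτ1 : τ ≤ 1) :
    modeEnergy lam a a₁ x τ ≤
      Real.exp (5 * B + 4 * |1 - q'| + 19) * modeEnergy lam a a₁ x 1 := by
  have hμ0 : 0 < μ := by linarith
  have hτp : 0 < τ := (inv_pos.2 hμ0).trans_le hτ0
  set M := 5 * B + 4 * |1 - q'| + 18 with hM
  have hM0 : 0 ≤ M := by positivity
  have hnn : ∀ σ : ℝ, 0 < σ → 0 ≤ modeEnergy lam a a₁ x σ := by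
    intro σ hσ
    unfold modeEnergy modePotential
    positivity
  choose! E' hE' hE'' using fun σ (h : 0 < σ ∧ σ ≤ 1) => hs.deriv_modeEnergy hB hμ hμl h.1 h.2
  -- An antiderivative of the Grönwall rate. Its singular part is at least `-1/4` when `μ τ ≥ 1`,
  -- which is why the constant is uniform in `μ`.
  have hK : ∀ σ : ℝ, 0 < σ → HasDerivAt (fun σ => M * σ - (4 * μ)⁻¹ * σ⁻¹)
      (M + 1 / (4 * μ * σ ^ 2)) σ := by
    intro σ hσ
    convert! ((hasDerivAt_id σ).const_mul M).sub ((hasDerivAt_inv hσ.ne').const_mul (4 * μ)⁻¹)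
      using 1
    field_simp
    ring
  have h := mul_exp_le_of_neg_mul_le_deriv hτ1
    (fun σ hσ => hE' σ ⟨hτp.trans_le hσ.1, hσ.2⟩) (fun σ hσ => hK σ (hτp.trans_le hσ.1))
    (fun σ hσ => hE'' σ ⟨hτp.trans_le hσ.1, hσ.2⟩)
  have h1 : Real.exp (-(1 / 4)) ≤ Real.exp (M * τ - (4 * μ)⁻¹ * τ⁻¹) := by
    gcongr
    have : (4 * μ)⁻¹ * τ⁻¹ ≤ 1 / 4 := by
      rw [← mul_inv, one_div]
      gcongr
      have := (inv_le_iff_one_le_mul₀' hμ0).1 hτ0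
      linarith
    nlinarith
  have h2 : Real.exp (M * 1 - (4 * μ)⁻¹ * 1⁻¹) ≤ Real.exp M := by
    gcongr
    have : 0 ≤ (4 * μ)⁻¹ * (1 : ℝ)⁻¹ := by positivity
    linarith
  have h3 : modeEnergy lam a a₁ x τ * Real.exp (-(1 / 4)) ≤
      modeEnergy lam a a₁ x 1 * Real.exp M :=
    (mul_le_mul_of_nonneg_left h1 (hnn τ hτp)).trans
      (h.trans (mul_le_mul_of_nonneg_left h2 (hnn 1 one_pos)))
  have h4 : modeEnergy lam a a₁ x τ =
      modeEnergy lam a a₁ x τ * Real.exp (-(1 / 4)) * Real.exp (1 / 4) := by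
    rw [mul_assoc, ← Real.exp_add]; simp
  rw [h4]
  calc _ ≤ modeEnergy lam a a₁ x 1 * Real.exp M * Real.exp (1 / 4) := by gcongr
    _ = Real.exp (M + 1 / 4) * modeEnergy lam a a₁ x 1 := by rw [Real.exp_add M]; ring
    _ ≤ _ := by
      refine mul_le_mul_of_nonneg_right (Real.exp_le_exp.2 ?_) (hnn 1 one_pos)
      linarith

end ModelScattering

/-! ### Energy estimate in the region `μ τ ≤ 1` -/

namespace ModelScattering

variable {q' B lam : ℝ} {a a₁ x : ℝ → ℝ}

/-- The energy controlling a mode in the region `μ τ ≤ 1`, in terms of the renormalized variables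
`p = τ a'` and `g = a - p log (μ τ)`. -/
noncomputable def modeInnerEnergy (μ : ℝ) (a a₁ x : ℝ → ℝ) (τ : ℝ) : ℝ :=
  (τ * a₁ τ) ^ 2 + (a τ - τ * a₁ τ * Real.log (μ * τ)) ^ 2 + x τ ^ 2 / μ

theorem log_nonpos_of_mul_le_one {μ τ : ℝ} (hμ : 0 < μ) (hτ0 : 0 < τ) (hτ : μ * τ ≤ 1) :
    Real.log (μ * τ) ≤ 0 :=
  Real.log_nonpos (mul_pos hμ hτ0).le hτ

theorem abs_add_mul_le (p g : ℝ) {L y : ℝ} (hL : L ≤ 0) (hy : 0 ≤ y) :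
    |g + p * L| ≤ (1 - L) * (|p| + |g| + y) := by
  refine (abs_add_le _ _).trans ?_
  rw [abs_mul, abs_of_nonpos hL]
  have h1 := mul_nonneg (by linarith : 0 ≤ -L) (abs_nonneg g)
  have h2 := mul_nonneg (by linarith : 0 ≤ 1 - L) hy
  linarith [abs_nonneg p]

/-- Every coefficient is at most a constant times `μ²`, since `lam² ≤ μ²`, `1 ≤ μ²` and `√μ ≤ μ²`.
The constant is written `… + 6 - 2` so that the `2` is kept in reserve for the contribution of
`x²/μ` to the derivative of the inner energy. -/
theorem abs_mul_forcing_le {B μ lam τ A a₁ X T r q' : ℝ} (hB : 0 ≤ B) (hμ : 1 ≤ μ)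
    (hμl : μ ^ 2 = 1 + lam ^ 2) (hτ0 : 0 ≤ τ) (hτ1 : τ ≤ 1)
    (hr : |r| ≤ B * (τ * |a₁| + τ ^ 2 * |A| + |X|)) (hp : τ * |a₁| ≤ T) (hA : |A| ≤ T)
    (hX : |X| ≤ √μ * T) :
    |τ * (r - 4 * q' * A - 4 * lam ^ 2 / (τ ^ 2 + 1) ^ 2 * A)| ≤
      τ * μ ^ 2 * ((4 * |q'| + 3 * B + 6 - 2) * T) := by
  have hT : 0 ≤ T := (abs_nonneg A).trans hA
  have hμ2 : 1 ≤ μ ^ 2 := one_le_pow₀ hμ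
  have h1 : |r| ≤ 3 * B * (μ ^ 2 * T) := by
    have hs : √μ ≤ μ ^ 2 := by
      rw [Real.sqrt_le_left (by positivity)]
      calc μ ≤ μ ^ 4 := le_self_pow₀ hμ (by norm_num)
        _ = _ := by ring
    have h2 : τ ^ 2 * |A| ≤ 1 * T := by
      gcongr
      exact pow_le_one₀ hτ0 hτ1
    have h3 : √μ * T ≤ μ ^ 2 * T := by gcongr
    have h4 : 1 * T ≤ μ ^ 2 * T := by gcongr
    refine hr.trans ?_
    rw [mul_comm 3 B, mul_assoc]
    exact mul_le_mul_of_nonneg_left (by linarith) hB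
  have h2 : |4 * q' * A| ≤ 4 * |q'| * (μ ^ 2 * T) := by
    rw [abs_mul, abs_mul, abs_of_pos (by norm_num : (0 : ℝ) < 4)]
    gcongr
    exact hA.trans (le_mul_of_one_le_left hT hμ2)
  have h3 : |4 * lam ^ 2 / (τ ^ 2 + 1) ^ 2 * A| ≤ 4 * (μ ^ 2 * T) := by
    rw [abs_mul, abs_of_nonneg (by positivity), ← mul_assoc]
    gcongr
    refine (div_le_self (by positivity) (one_le_pow₀ (by nlinarith))).trans ?_
    linarith
  rw [abs_mul, abs_of_nonneg hτ0, mul_assoc τ]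
  refine mul_le_mul_of_nonneg_left ?_ hτ0
  calc _ ≤ |r| + |4 * q' * A| + |4 * lam ^ 2 / (τ ^ 2 + 1) ^ 2 * A| :=
        (abs_sub _ _).trans (add_le_add_left (abs_sub _ _) _)
    _ ≤ _ := by linarith

-- The renormalization makes both variables slow. The derivative of `p = τ a'` contains no `a'/τ`,
-- and in `g' = a' - p' L - p/τ` the singular terms cancel, leaving `-p' L`. As `a = g + p L`, one
-- factor `1 - L` comes from `a` and a second one from `g'`.
set_option maxHeartbeats 600000 in
theorem IsModeSolution.deriv_modeInnerEnergy (hs : IsModeSolution q' B lam a a₁ x) (hB : 0 ≤ B)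
    {τ μ : ℝ} (hμ : 1 ≤ μ) (hμl : μ ^ 2 = 1 + lam ^ 2) (hτ0 : 0 < τ) (hτ : μ * τ ≤ 1) :
    ∃ E' : ℝ, HasDerivAt (modeInnerEnergy μ a a₁ x) E' τ ∧
      -((6 * (4 * |q'| + 3 * B + 6)) * (τ * μ ^ 2 * (1 - Real.log (μ * τ)) ^ 2)
        * modeInnerEnergy μ a a₁ x τ) ≤ E' := by
  obtain ⟨r, hr, ha₁⟩ := hs.deriv_a₁ τ hτ0
  have ha := hs.deriv_a τ hτ0
  have hx := hs.deriv_x τ hτ0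
  have hμ0 : 0 < μ := by linarith
  have hτ1 : τ ≤ 1 := by nlinarith
  have hL := log_nonpos_of_mul_le_one hμ0 hτ0 hτ
  have hLd : HasDerivAt (fun σ => Real.log (μ * σ)) τ⁻¹ τ := by
    convert! ((hasDerivAt_id' τ).const_mul μ).log (by positivity) using 1
    field_simp
  set A := a τ with hA
  set X := x τ with hX
  set p := τ * a₁ τ with hp
  set L := Real.log (μ * τ) with hLdef
  set g := A - p * L with hg
  set p' : ℝ := τ * (r - 4 * q' * A - 4 * lam ^ 2 / (τ ^ 2 + 1) ^ 2 * A) with hp'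
  have hτne := hτ0.ne'
  have hpd : HasDerivAt (fun σ => σ * a₁ σ) p' τ := by
    convert! (hasDerivAt_id' τ).mul ha₁ using 1
    rw [hp']; field_simp; ring
  have hgd : HasDerivAt (fun σ => a σ - σ * a₁ σ * Real.log (μ * σ)) (-(p' * L)) τ := by
    convert! ha.sub (hpd.mul hLd) using 1
    field_simp; ring
  have hEd := ((hpd.pow 2).add (hgd.pow 2)).add ((hx.pow 2).div_const μ)
  have key : HasDerivAt (modeInnerEnergy μ a a₁ x)
      (2 * p * p' - 2 * g * (p' * L) + 4 * τ * A * X / μ) τ := by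
    convert! hEd using 1
    simp only [← hA, ← hp, ← hX, ← hLdef, ← hg]
    push_cast
    ring
  refine ⟨_, key, ?_⟩
  set N := 4 * |q'| + 3 * B + 6 with hN
  set l := 1 - L with hl
  have hl1 : 1 ≤ l := by linarith
  -- This scaling turns the energy into `p² + g² + y²`, so that the single quantity `S` controls all
  -- three variables.
  set y := |X| / √μ with hy
  have hsμ : 1 ≤ √μ := Real.one_le_sqrt.2 hμ
  have hsμ2 : √μ ^ 2 = μ := Real.sq_sqrt hμ0.le
  have hXy : |X| = √μ * y := by rw [hy]; field_simp
  have hy0 : 0 ≤ y := by positivity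
  have hE : modeInnerEnergy μ a a₁ x τ = p ^ 2 + g ^ 2 + y ^ 2 := by
    have : y ^ 2 = X ^ 2 / μ := by rw [hy, div_pow, sq_abs, hsμ2]
    rw [this]; rfl
  set S := |p| + |g| + y with hS
  have hS0 : 0 ≤ S := by positivity
  have hS2 : S ^ 2 ≤ 3 * modeInnerEnergy μ a a₁ x τ := by
    rw [hE, hS]
    nlinarith [sq_nonneg (|p| - |g|), sq_nonneg (|p| - y), sq_nonneg (|g| - y), sq_abs p, sq_abs g]
  have hAS : |A| ≤ l * S := by
    have h1 : A = g + p * L := by rw [hg]; ring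
    rw [h1]
    exact abs_add_mul_le p g hL hy0
  have hp'S : |p'| ≤ τ * μ ^ 2 * ((N - 2) * (l * S)) := by
    have hSl : S ≤ l * S := le_mul_of_one_le_left hS0 hl1
    have hpS : τ * |a₁ τ| ≤ l * S := by
      have : τ * |a₁ τ| = |p| := by rw [hp, abs_mul, abs_of_pos hτ0]
      rw [this]
      refine le_trans ?_ hSl
      rw [hS]; linarith [abs_nonneg g]
    have hyS : y ≤ l * S := le_trans (by rw [hS]; linarith [abs_nonneg g, abs_nonneg p]) hSl
    have hXS : |X| ≤ √μ * (l * S) := hXy.trans_le (mul_le_mul_of_nonneg_left hyS (Real.sqrt_nonneg μ))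
    generalize l * S = T at *
    exact abs_mul_forcing_le hB hμ hμl hτ0.le hτ1 hr hpS hAS hXS
  have hτκ : τ ≤ τ * μ ^ 2 := le_mul_of_one_le_right hτ0.le (one_le_pow₀ hμ)
  have hXμ : |X / μ| ≤ S := by
    rw [abs_div, abs_of_pos hμ0, hXy, div_le_iff₀ hμ0]
    have h1 : √μ ≤ μ := by nlinarith
    have h2 : y ≤ S := by rw [hS]; linarith [abs_nonneg g, abs_nonneg p]
    calc √μ * y ≤ μ * S := by gcongr
      _ = S * μ := mul_comm _ _
  have hpS : |p| ≤ S := by rw [hS]; linarith [abs_nonneg g]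
  have hgS : |g| ≤ S := by rw [hS]; linarith [abs_nonneg p]
  have hLl : |L| ≤ l := by rw [abs_of_nonpos hL]; linarith
  have hpgS : |p| + |g| ≤ S := by rw [hS]; linarith
  clear_value S N l L g p' y p A X
  set κ := τ * μ ^ 2 with hκ
  have hκ0 : 0 ≤ κ := by positivity
  have hN2 : 0 ≤ N - 2 := by rw [hN]; linarith [abs_nonneg q']
  -- The terms with `p'` cost `2 (N - 2)` and the term with `A * X / μ` costs `4`, which together
  -- make `2 N`.
  have e1 : -(2 * N * (κ * l ^ 2) * S ^ 2) ≤
      2 * p * p' - 2 * g * (p' * L) + 4 * τ * A * X / μ := by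
    have h1 : |p * p'| ≤ |p| * (κ * ((N - 2) * (l * S))) * l := by
      rw [abs_mul]
      refine (mul_le_mul_of_nonneg_left hp'S (abs_nonneg p)).trans (le_mul_of_one_le_right ?_ hl1)
      exact mul_nonneg (abs_nonneg p) ((abs_nonneg _).trans hp'S)
    have h2 : |g * (p' * L)| ≤ |g| * (κ * ((N - 2) * (l * S)) * l) := by
      rw [abs_mul, abs_mul]
      gcongr
    have h3 : |τ * A * (X / μ)| ≤ κ * (l * S) * l * S := by
      rw [abs_mul, abs_mul, abs_of_pos hτ0]
      have : κ * (l * S) ≤ κ * (l * S) * l := le_mul_of_one_le_right (by positivity) hl1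
      have h4 : τ * |A| ≤ κ * (l * S) := by gcongr
      exact mul_le_mul (h4.trans this) hXμ (abs_nonneg _) (by positivity)
    have h4 : (|p| + |g|) * (κ * ((N - 2) * (l * S)) * l) ≤ S * (κ * ((N - 2) * (l * S)) * l) := by
      gcongr
    have h5 : 2 * p * p' - 2 * g * (p' * L) + 4 * τ * A * X / μ
        = 2 * (p * p') - 2 * (g * (p' * L)) + 4 * (τ * A * (X / μ)) := by ring
    rw [h5]
    linarith [(abs_le.1 h1).1, (abs_le.1 h2).2, (abs_le.1 h3).1]
  have e2 : N * (κ * l ^ 2) * S ^ 2 ≤ N * (κ * l ^ 2) * (3 * modeInnerEnergy μ a a₁ x τ) :=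
    mul_le_mul_of_nonneg_left hS2 (mul_nonneg (by linarith) (by positivity))
  refine le_trans ?_ e1
  generalize modeInnerEnergy μ a a₁ x τ = E at *
  linarith

end ModelScattering

/-! ### Matching the two regions and the asymptotic data of a mode -/

namespace ModelScattering

variable {q' B lam : ℝ} {a a₁ x : ℝ → ℝ}

theorem modeInnerEnergy_nonneg {μ : ℝ} (hμ : 0 ≤ μ) (a a₁ x : ℝ → ℝ) (τ : ℝ) :
    0 ≤ modeInnerEnergy μ a a₁ x τ := by
  unfold modeInnerEnergy; positivity

theorem modeEnergy_nonneg {τ : ℝ} (hτ : 0 ≤ τ) (lam : ℝ) (a a₁ x : ℝ → ℝ) :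
    0 ≤ modeEnergy lam a a₁ x τ := by
  unfold modeEnergy modePotential; positivity

/-- In the variable `s = μ τ` this is an antiderivative of `s (1 - log s)²`. It is nonnegative for
`0 < s ≤ 1` and equals `5/4` at `s = 1`, which bounds the Grönwall exponent independently of `μ`. -/
theorem hasDerivAt_innerWeight {μ τ : ℝ} (hμ : 0 < μ) (hτ : 0 < τ) :
    HasDerivAt (fun σ => (μ * σ) ^ 2 / 2 * ((1 - Real.log (μ * σ)) ^ 2
      + (1 - Real.log (μ * σ)) + 1 / 2)) (τ * μ ^ 2 * (1 - Real.log (μ * τ)) ^ 2) τ := by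
  have hm : HasDerivAt (fun σ => μ * σ) μ τ := by simpa using (hasDerivAt_id' τ).const_mul μ
  have hl : HasDerivAt (fun σ => 1 - Real.log (μ * σ)) (-τ⁻¹) τ := by
    convert! (hm.log (by positivity)).const_sub 1 using 1
    field_simp
  convert! ((hm.pow 2).div_const 2).mul (((hl.pow 2).add hl).add_const (1 / 2)) using 1
  simp only [Pi.pow_apply, Pi.add_apply]
  push_cast
  field_simp
  ring

/-- The energy in the inner region is controlled by its value at the transition time. -/
theorem IsModeSolution.modeInnerEnergy_le (hs : IsModeSolution q' B lam a a₁ x) (hB : 0 ≤ B)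
    {τ μ : ℝ} (hμ : 1 ≤ μ) (hμl : μ ^ 2 = 1 + lam ^ 2) (hτ0 : 0 < τ) (hτ : τ ≤ μ⁻¹) :
    modeInnerEnergy μ a a₁ x τ ≤
      Real.exp (8 * (4 * |q'| + 3 * B + 6)) * modeInnerEnergy μ a a₁ x μ⁻¹ := by
  have hμ0 : 0 < μ := by linarith
  set M := 6 * (4 * |q'| + 3 * B + 6) with hM
  have hM0 : 0 ≤ M := by positivity
  have hle : ∀ σ ≤ μ⁻¹, μ * σ ≤ 1 := fun σ hσ => by
    calc μ * σ ≤ μ * μ⁻¹ := by gcongr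
      _ = 1 := mul_inv_cancel₀ hμ0.ne'
  choose! E' hE' hE'' using fun σ (h : 0 < σ ∧ μ * σ ≤ 1) =>
    hs.deriv_modeInnerEnergy hB hμ hμl h.1 h.2
  have h := mul_exp_le_of_neg_mul_le_deriv hτ
    (fun σ hσ => hE' σ ⟨hτ0.trans_le hσ.1, hle σ hσ.2⟩)
    (fun σ hσ => (hasDerivAt_innerWeight hμ0 (hτ0.trans_le hσ.1)).const_mul M)
    (fun σ hσ => hE'' σ ⟨hτ0.trans_le hσ.1, hle σ hσ.2⟩)
  have hn := modeInnerEnergy_nonneg hμ0.le a a₁ x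
  have hL := log_nonpos_of_mul_le_one hμ0 hτ0 (hle τ hτ)
  calc modeInnerEnergy μ a a₁ x τ ≤ modeInnerEnergy μ a a₁ x τ *
        Real.exp (M * ((μ * τ) ^ 2 / 2 * ((1 - Real.log (μ * τ)) ^ 2
          + (1 - Real.log (μ * τ)) + 1 / 2))) := by
        refine le_mul_of_one_le_right (hn τ) (Real.one_le_exp (mul_nonneg hM0 ?_))
        have : 0 ≤ 1 - Real.log (μ * τ) := by linarith
        positivity
    _ ≤ _ := h
    _ ≤ _ := by
        rw [mul_comm]
        refine mul_le_mul_of_nonneg_right (Real.exp_le_exp.2 ?_) (hn _)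
        -- The exponent is `6 * 5/4 = 7.5` times the bracket, rounded up to `8`.
        rw [mul_inv_cancel₀ hμ0.ne', Real.log_one]
        linarith

/-- At `τ = 1/μ` the logarithm vanishes, so `g = a` and `p = u/μ - a/2`. Since `W ≥ μ²`, each of
`(u/μ)²`, `a²` and `x²/μ` is at most `1/μ` times the corresponding term of the outer energy; this
dictates the weight of `x²` in the inner one. -/
theorem modeInnerEnergy_inv_le {μ : ℝ} (hμ : 1 ≤ μ) (hμl : μ ^ 2 = 1 + lam ^ 2) (a a₁ x : ℝ → ℝ) :
    modeInnerEnergy μ a a₁ x μ⁻¹ ≤ 5 / μ * modeEnergy lam a a₁ x μ⁻¹ := by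
  have hμ0 : 0 < μ := by linarith
  have hW := le_modePotential lam (inv_pos.2 hμ0).le (inv_le_one_of_one_le₀ hμ)
  set u := a₁ μ⁻¹ + a μ⁻¹ / (2 * μ⁻¹) with hu
  have h1 : modeEnergy lam a a₁ x μ⁻¹ =
      μ⁻¹ * u ^ 2 + μ⁻¹ * (modePotential lam μ⁻¹ * a μ⁻¹ ^ 2) + x μ⁻¹ ^ 2 := rfl
  have h2 : modeInnerEnergy μ a a₁ x μ⁻¹ =
      (μ⁻¹ * u - a μ⁻¹ / 2) ^ 2 + a μ⁻¹ ^ 2 + x μ⁻¹ ^ 2 / μ := by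
    unfold modeInnerEnergy
    rw [mul_inv_cancel₀ hμ0.ne', Real.log_one, hu]
    field_simp
    ring
  have h3 : μ ^ 2 * a μ⁻¹ ^ 2 ≤ modePotential lam μ⁻¹ * a μ⁻¹ ^ 2 := by
    gcongr; linarith
  have h4 : a μ⁻¹ ^ 2 ≤ 1 / μ * (μ⁻¹ * (modePotential lam μ⁻¹ * a μ⁻¹ ^ 2)) := by
    calc a μ⁻¹ ^ 2 = 1 / μ * (μ⁻¹ * (μ ^ 2 * a μ⁻¹ ^ 2)) := by field_simp
      _ ≤ _ := by gcongr
  have h5 : (5 : ℝ) / μ = 5 * (1 / μ) := by ring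
  have h6 : x μ⁻¹ ^ 2 / μ = 1 / μ * x μ⁻¹ ^ 2 := by ring
  have h7 : (μ⁻¹ * u) ^ 2 = 1 / μ * (μ⁻¹ * u ^ 2) := by field_simp
  have h8 : 0 ≤ 1 / μ * (μ⁻¹ * u ^ 2) := by positivity
  have h9 : 0 ≤ 1 / μ * x μ⁻¹ ^ 2 := by positivity
  have h10 : (μ⁻¹ * u - a μ⁻¹ / 2) ^ 2 ≤ 2 * (μ⁻¹ * u) ^ 2 + a μ⁻¹ ^ 2 := by
    nlinarith [sq_nonneg (μ⁻¹ * u + a μ⁻¹ / 2), sq_nonneg (a μ⁻¹)]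
  rw [h1, h2, h5, h6]
  rw [h7] at h10
  linarith [sq_nonneg (a μ⁻¹)]

theorem modeEnergy_one_le {μ : ℝ} (hμl : μ ^ 2 = 1 + lam ^ 2) (a a₁ x : ℝ → ℝ) :
    modeEnergy lam a a₁ x 1 ≤ 5 * (μ ^ 2 * a 1 ^ 2 + a₁ 1 ^ 2 + x 1 ^ 2) := by
  have hW : modePotential lam 1 = lam ^ 2 + 4 := by unfold modePotential; ring
  unfold modeEnergy
  rw [hW, hμl]
  nlinarith [sq_nonneg (a₁ 1 - a 1 / 2), sq_nonneg (lam * a 1), sq_nonneg (a 1), sq_nonneg (x 1),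
    sq_nonneg (a₁ 1)]

/-- The constant in the estimates of a single mode. -/
noncomputable def modeConst (q' B : ℝ) : ℝ :=
  Real.exp (8 * (4 * |q'| + 3 * B + 6)) * Real.exp (5 * B + 4 * |1 - q'| + 19)

theorem IsModeSolution.modeInnerEnergy_le_one (hs : IsModeSolution q' B lam a a₁ x) (hB : 0 ≤ B)
    {τ μ : ℝ} (hμ : 1 ≤ μ) (hμl : μ ^ 2 = 1 + lam ^ 2) (hτ0 : 0 < τ) (hτ : τ ≤ μ⁻¹) :
    modeInnerEnergy μ a a₁ x τ ≤
      5 * modeConst q' B / μ * modeEnergy lam a a₁ x 1 := by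
  calc _ ≤ _ := hs.modeInnerEnergy_le hB hμ hμl hτ0 hτ
    _ ≤ Real.exp (8 * (4 * |q'| + 3 * B + 6)) * (5 / μ *
        (Real.exp (5 * B + 4 * |1 - q'| + 19) * modeEnergy lam a a₁ x 1)) := by
      gcongr
      exact (modeInnerEnergy_inv_le hμ hμl a a₁ x).trans (mul_le_mul_of_nonneg_left
        (hs.modeEnergy_le hB hμ hμl le_rfl (inv_le_one_of_one_le₀ hμ)) (by positivity))
    _ = _ := by unfold modeConst; ring

theorem mul_one_sub_log_le_one {s : ℝ} (hs : 0 < s) : s * (1 - Real.log s) ≤ 1 := by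
  have h := Real.log_le_sub_one_of_pos (inv_pos.2 hs)
  rw [Real.log_inv] at h
  calc s * (1 - Real.log s) ≤ s * s⁻¹ := by gcongr; linarith
    _ = 1 := mul_inv_cancel₀ hs.ne'

/-- This gains a whole factor `1/μ` for the derivative of `x`. In the inner region `τ |a|` is at
most `τ (1 - log (μ τ)) (|p| + |g|)`, and `s (1 - log s) ≤ 1`. In the outer region `τ μ² a²` is part
of the energy. -/
theorem IsModeSolution.abs_deriv_x_le (hs : IsModeSolution q' B lam a a₁ x) (hB : 0 ≤ B)
    {τ μ : ℝ} (hμ : 1 ≤ μ) (hμl : μ ^ 2 = 1 + lam ^ 2) (hτ0 : 0 < τ) (hτ : τ ≤ 1) :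
    |2 * τ * a τ| ≤ √(40 * modeConst q' B * (modeEnergy lam a a₁ x 1 / μ ^ 2)) := by
  have hμ0 : 0 < μ := by linarith
  have hE1 := modeEnergy_nonneg zero_le_one lam a a₁ x
  have hC0 : 0 < modeConst q' B := by unfold modeConst; positivity
  apply Real.abs_le_sqrt
  rcases le_total τ μ⁻¹ with h | h
  · have hs1 : μ * τ ≤ 1 := by
      calc μ * τ ≤ μ * μ⁻¹ := by gcongr
        _ = 1 := mul_inv_cancel₀ hμ0.ne'
    have hL := log_nonpos_of_mul_le_one hμ0 hτ0 hs1
    have hE := hs.modeInnerEnergy_le_one hB hμ hμl hτ0 h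
    set p := τ * a₁ τ with hp
    set g := a τ - p * Real.log (μ * τ) with hg
    have hpg : p ^ 2 + g ^ 2 ≤ modeInnerEnergy μ a a₁ x τ := by
      unfold modeInnerEnergy
      have : 0 ≤ x τ ^ 2 / μ := by positivity
      linarith
    have h1 := abs_add_mul_le p g hL le_rfl
    rw [show g + p * Real.log (μ * τ) = a τ by rw [hg]; ring, add_zero] at h1
    have h2 : μ * |2 * τ * a τ| ≤ 2 * (|p| + |g|) := by
      rw [abs_mul, abs_of_pos (by positivity : 0 < 2 * τ)]
      calc μ * (2 * τ * |a τ|) ≤ μ * (2 * τ * ((1 - Real.log (μ * τ)) * (|p| + |g|))) := by gcongr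
        _ = 2 * (μ * τ * (1 - Real.log (μ * τ))) * (|p| + |g|) := by ring
        _ ≤ 2 * 1 * (|p| + |g|) := by
          gcongr
          exact mul_one_sub_log_le_one (mul_pos hμ0 hτ0)
        _ = _ := by ring
    have h3 : (μ * |2 * τ * a τ|) ^ 2 ≤ 8 * (p ^ 2 + g ^ 2) := by
      calc (μ * |2 * τ * a τ|) ^ 2 ≤ (2 * (|p| + |g|)) ^ 2 := by gcongr
        _ ≤ 8 * (p ^ 2 + g ^ 2) := by
          nlinarith [sq_nonneg (|p| - |g|), sq_abs p, sq_abs g]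
    have h4 : 5 * modeConst q' B / μ * modeEnergy lam a a₁ x 1 ≤
        5 * modeConst q' B * modeEnergy lam a a₁ x 1 := by
      gcongr
      exact div_le_self (by positivity) hμ
    rw [mul_pow, sq_abs] at h3
    rw [← mul_div_assoc, le_div_iff₀ (by positivity)]
    linarith
  · have hE := hs.modeEnergy_le hB hμ hμl h hτ
    have hW := le_modePotential lam hτ0.le hτ
    have h1 : τ * (μ ^ 2 * a τ ^ 2) ≤ modeEnergy lam a a₁ x τ := by
      have h2 : τ * (μ ^ 2 * a τ ^ 2) ≤ τ * (modePotential lam τ * a τ ^ 2) := by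
        gcongr; linarith
      refine h2.trans ?_
      unfold modeEnergy
      have : 0 ≤ τ * (a₁ τ + a τ / (2 * τ)) ^ 2 := by positivity
      nlinarith [sq_nonneg (x τ)]
    have h2 : Real.exp (5 * B + 4 * |1 - q'| + 19) ≤ modeConst q' B := by
      unfold modeConst
      exact le_mul_of_one_le_left (Real.exp_pos _).le (Real.one_le_exp (by positivity))
    have h3 : τ * (μ ^ 2 * a τ ^ 2) ≤ modeConst q' B * modeEnergy lam a a₁ x 1 :=
      h1.trans (hE.trans (by gcongr))
    rw [← mul_div_assoc, le_div_iff₀ (by positivity)]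
    -- The quantity to bound contains `τ² a²` and the energy controls `τ a²`; the extra `τ` is at
    -- most one.
    have h4 : τ * (τ * (μ ^ 2 * a τ ^ 2)) ≤ 1 * (τ * (μ ^ 2 * a τ ^ 2)) := by gcongr
    have h5 : 0 ≤ modeConst q' B * modeEnergy lam a a₁ x 1 := by positivity
    linarith

theorem sqrt_le_mul_add {D c u v w : ℝ} (hc : 0 ≤ c)
    (h : D ≤ c ^ 2 * (u ^ 2 + v ^ 2 + w ^ 2)) : √D ≤ c * (|u| + |v| + |w|) := by
  rw [Real.sqrt_le_left (by positivity), mul_pow]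
  refine h.trans (mul_le_mul_of_nonneg_left ?_ (sq_nonneg c))
  nlinarith [sq_abs u, sq_abs v, sq_abs w, mul_nonneg (abs_nonneg u) (abs_nonneg v),
    mul_nonneg (abs_nonneg u) (abs_nonneg w), mul_nonneg (abs_nonneg v) (abs_nonneg w)]

/-- The asymptotic coefficients at `τ = 0` of a mode are controlled by its Cauchy data at time one,
uniformly in the frequency. -/
theorem IsModeSolution.asymptotic_data_le (hs : IsModeSolution q' B lam a a₁ x) (hB : 0 ≤ B)
    {μ o h x₀ : ℝ} (hμ : 1 ≤ μ) (hμl : μ ^ 2 = 1 + lam ^ 2)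
    (ho : Tendsto (fun τ => τ * a₁ τ) (𝓝[>] 0) (𝓝 o))
    (hh : Tendsto (fun τ => a τ - τ * a₁ τ * Real.log τ) (𝓝[>] 0) (𝓝 h))
    (hx₀ : Tendsto x (𝓝[>] 0) (𝓝 x₀)) :
    |o| ≤ 5 * √(modeConst q' B) * (√μ * |a 1| + (√μ)⁻¹ * |a₁ 1| + (√μ)⁻¹ * |x 1|) ∧
    |h - o * Real.log μ| ≤
      5 * √(modeConst q' B) * (√μ * |a 1| + (√μ)⁻¹ * |a₁ 1| + (√μ)⁻¹ * |x 1|) ∧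
    |x₀| ≤ (15 * √(modeConst q' B) + 1) * (|a 1| + μ⁻¹ * |a₁ 1| + |x 1|) := by
  have hμ0 : 0 < μ := by linarith
  have hC0 : 0 < modeConst q' B := by unfold modeConst; positivity
  have hE1 := modeEnergy_one_le hμl a a₁ x
  set D := 5 * modeConst q' B / μ * modeEnergy lam a a₁ x 1 with hD
  have hsμ2 : √μ ^ 2 = μ := Real.sq_sqrt hμ0.le
  have hDle : √D ≤ 5 * √(modeConst q' B) *
      (√μ * |a 1| + (√μ)⁻¹ * |a₁ 1| + (√μ)⁻¹ * |x 1|) := by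
    have h1 := sqrt_le_mul_add (D := D) (c := 5 * √(modeConst q' B)) (u := √μ * a 1)
      (v := (√μ)⁻¹ * a₁ 1) (w := (√μ)⁻¹ * x 1) (by positivity) ?_
    · simpa only [abs_mul, abs_inv, abs_of_nonneg (Real.sqrt_nonneg μ)] using h1
    · rw [mul_pow, mul_pow, mul_pow, mul_pow, inv_pow, hsμ2, Real.sq_sqrt hC0.le, hD]
      calc _ ≤ 5 * modeConst q' B / μ * (5 * (μ ^ 2 * a 1 ^ 2 + a₁ 1 ^ 2 + x 1 ^ 2)) := by gcongr
        _ = _ := by field_simp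
  have hev : ∀ᶠ τ in 𝓝[>] (0 : ℝ), τ ∈ Ioo 0 μ⁻¹ := Ioo_mem_nhdsGT (inv_pos.2 hμ0)
  -- The inner energy sees the logarithm of `μ τ` and the expansion that of `τ`. The discrepancy `o
  -- log μ` is the origin of the multiplier `log ∇`.
  have hg : Tendsto (fun τ => a τ - τ * a₁ τ * Real.log (μ * τ)) (𝓝[>] 0)
      (𝓝 (h - o * Real.log μ)) := by
    refine (hh.sub (ho.mul_const (Real.log μ))).congr' ?_
    filter_upwards [hev] with τ hτ
    rw [Real.log_mul hμ0.ne' hτ.1.ne']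
    ring
  refine ⟨?_, ?_, ?_⟩
  · refine le_trans ?_ hDle
    apply Real.abs_le_sqrt
    refine le_of_tendsto (ho.pow 2) ?_
    filter_upwards [hev] with τ hτ
    refine le_trans ?_ (hs.modeInnerEnergy_le_one hB hμ hμl hτ.1 hτ.2.le)
    unfold modeInnerEnergy
    have : 0 ≤ x τ ^ 2 / μ := by positivity
    linarith [sq_nonneg (a τ - τ * a₁ τ * Real.log (μ * τ))]
  · refine le_trans ?_ hDle
    apply Real.abs_le_sqrt
    refine le_of_tendsto (hg.pow 2) ?_
    filter_upwards [hev] with τ hτ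
    refine le_trans ?_ (hs.modeInnerEnergy_le_one hB hμ hμl hτ.1 hτ.2.le)
    unfold modeInnerEnergy
    have : 0 ≤ x τ ^ 2 / μ := by positivity
    linarith [sq_nonneg (τ * a₁ τ)]
  · set R := √(40 * modeConst q' B * (modeEnergy lam a a₁ x 1 / μ ^ 2)) with hR
    have h1 : |x₀ - x 1| ≤ R := by
      refine le_of_tendsto (hx₀.sub_const (x 1)).abs ?_
      filter_upwards [Ioo_mem_nhdsGT (one_pos : (0 : ℝ) < 1)] with τ hτ
      have h2 := Convex.norm_image_sub_le_of_norm_hasDerivWithin_le (f := x)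
        (f' := fun σ => 2 * σ * a σ) (s := Icc τ 1) (C := R) (x := 1) (y := τ)
        (fun σ hσ => (hs.deriv_x σ (hτ.1.trans_le hσ.1)).hasDerivWithinAt)
        (fun σ hσ => hs.abs_deriv_x_le hB hμ hμl (hτ.1.trans_le hσ.1) hσ.2)
        (convex_Icc τ 1) (right_mem_Icc.2 hτ.2.le) (left_mem_Icc.2 hτ.2.le)
      rw [Real.norm_eq_abs, Real.norm_eq_abs] at h2
      refine h2.trans (mul_le_of_le_one_right (Real.sqrt_nonneg _) ?_)
      rw [abs_le]; constructor <;> linarith [hτ.1, hτ.2]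
    have h2 : R ≤ 15 * √(modeConst q' B) * (|a 1| + μ⁻¹ * |a₁ 1| + |x 1|) := by
      have h3 := sqrt_le_mul_add (D := 40 * modeConst q' B * (modeEnergy lam a a₁ x 1 / μ ^ 2))
        (c := 15 * √(modeConst q' B)) (u := a 1) (v := μ⁻¹ * a₁ 1) (w := x 1) (by positivity) ?_
      · simpa only [abs_mul, abs_inv, abs_of_pos hμ0] using h3
      · rw [mul_pow, mul_pow, Real.sq_sqrt hC0.le]
        have h4 : modeEnergy lam a a₁ x 1 / μ ^ 2 ≤
            5 * (a 1 ^ 2 + μ⁻¹ ^ 2 * a₁ 1 ^ 2 + x 1 ^ 2) := by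
          rw [div_le_iff₀ (by positivity)]
          refine hE1.trans ?_
          have h5 : x 1 ^ 2 ≤ μ ^ 2 * x 1 ^ 2 :=
            le_mul_of_one_le_left (sq_nonneg _) (one_le_pow₀ hμ)
          have h6 : 5 * (a 1 ^ 2 + μ⁻¹ ^ 2 * a₁ 1 ^ 2 + x 1 ^ 2) * μ ^ 2 =
              5 * (μ ^ 2 * a 1 ^ 2 + a₁ 1 ^ 2 + μ ^ 2 * x 1 ^ 2) := by field_simp
          rw [h6]
          linarith
        -- The factor `40 * 5 = 200` is rounded up to the square `225 = 15²`.
        calc _ ≤ 40 * modeConst q' B * (5 * (a 1 ^ 2 + μ⁻¹ ^ 2 * a₁ 1 ^ 2 + x 1 ^ 2)) := by gcongr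
          _ = 200 * (modeConst q' B * (a 1 ^ 2 + μ⁻¹ ^ 2 * a₁ 1 ^ 2 + x 1 ^ 2)) := by ring
          _ ≤ 225 * (modeConst q' B * (a 1 ^ 2 + μ⁻¹ ^ 2 * a₁ 1 ^ 2 + x 1 ^ 2)) := by
            gcongr; norm_num
          _ = _ := by ring
    have h3 : |x₀| ≤ |x₀ - x 1| + |x 1| := by
      have := abs_add_le (x₀ - x 1) (x 1)
      rwa [sub_add_cancel] at this
    have h4 : 0 ≤ μ⁻¹ * |a₁ 1| := by positivity
    linarith [abs_nonneg (a 1)]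

end ModelScattering

noncomputable section

namespace ModelScattering

variable {n : ℕ}

/-! ### Radially constant extensions -/

theorem radialExt_of_ne {f : Sphere n → ℝ} {y : EuclideanSpace ℝ (Fin (n + 1))} (hy : y ≠ 0) :
    radialExt f y = f (radialProj y hy) := by
  simp [radialExt, hy]

theorem sphere_ne_zero (x : Sphere n) : (x : EuclideanSpace ℝ (Fin (n + 1))) ≠ 0 :=
  ne_zero_of_mem_unit_sphere x

theorem radialProj_coe (x : Sphere n) : radialProj (x : EuclideanSpace ℝ (Fin (n + 1)))
    (sphere_ne_zero x) = x := by
  ext1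
  simp [radialProj]

@[simp]
theorem radialExt_coe (f : Sphere n → ℝ) (x : Sphere n) :
    radialExt f (x : EuclideanSpace ℝ (Fin (n + 1))) = f x := by
  rw [radialExt_of_ne (sphere_ne_zero x), radialProj_coe]

theorem radialExt_smul (f : Sphere n → ℝ) {c : ℝ} (hc : 0 < c)
    (y : EuclideanSpace ℝ (Fin (n + 1))) : radialExt f (c • y) = radialExt f y := by
  by_cases hy : y = 0
  · simp [hy]
  · rw [radialExt_of_ne hy, radialExt_of_ne (smul_ne_zero hc.ne' hy)]
    congr 1
    ext1
    simp only [radialProj, norm_smul, Real.norm_eq_abs, abs_of_pos hc, smul_smul]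
    congr 1
    field_simp

/-- The radial extension of a smooth family is smooth. -/
theorem SmoothOnPositiveTimes.contDiffOn {u : ℝ → Sphere n → ℝ} (hu : SmoothOnPositiveTimes u) :
    ContDiffOn ℝ ∞ (fun p : ℝ × EuclideanSpace ℝ (Fin (n + 1)) => radialExt (u p.1) p.2)
      (Ioi 0 ×ˢ {0}ᶜ) := by
  let V : TopologicalSpace.Opens (ℝ × EuclideanSpace ℝ (Fin (n + 1))) :=
    ⟨Ioi 0 ×ˢ {0}ᶜ, isOpen_Ioi.prod isOpen_compl_singleton⟩
  have hval : ContMDiff 𝓘(ℝ, ℝ × EuclideanSpace ℝ (Fin (n + 1)))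
      𝓘(ℝ, ℝ × EuclideanSpace ℝ (Fin (n + 1))) ∞ (Subtype.val : V → _) := contMDiff_subtype_val
  have hfst : ContMDiff 𝓘(ℝ, ℝ × EuclideanSpace ℝ (Fin (n + 1))) 𝓘(ℝ, ℝ) ∞
      (fun p : V => p.1.1) := contDiff_fst.contMDiff.comp hval
  have hne : ∀ p : V, p.1.2 ≠ 0 := fun p => p.2.2
  have hnorm : ContMDiff 𝓘(ℝ, ℝ × EuclideanSpace ℝ (Fin (n + 1)))
      𝓘(ℝ, EuclideanSpace ℝ (Fin (n + 1))) ∞ (fun p : V => (‖p.1.2‖)⁻¹ • p.1.2) := by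
    intro p
    have h : ContDiffAt ℝ ∞ (fun q : ℝ × EuclideanSpace ℝ (Fin (n + 1)) => (‖q.2‖)⁻¹ • q.2) p.1 :=
      ((contDiffAt_snd.norm ℝ (hne p)).inv (norm_ne_zero_iff.2 (hne p))).smul contDiffAt_snd
    exact h.contMDiffAt.comp p (hval p)
  have : Fact (Module.finrank ℝ (EuclideanSpace ℝ (Fin (n + 1))) = n + 1) := ⟨by simp⟩
  have hproj : ContMDiff 𝓘(ℝ, ℝ × EuclideanSpace ℝ (Fin (n + 1))) (𝓡 n) ∞
      (fun p : V => radialProj p.1.2 (hne p)) :=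
    hnorm.codRestrict_sphere fun p => (radialProj p.1.2 (hne p)).2
  have hcomp := ContMDiffOn.comp_contMDiff hu (hfst.prodMk hproj) fun p => ⟨p.2.1, mem_univ _⟩
  intro p hp
  refine ContDiffAt.contDiffWithinAt ?_
  rw [← contMDiffAt_iff_contDiffAt, ← contMDiffAt_subtype_iff (U := V) (x := ⟨p, hp⟩)]
  convert! hcomp ⟨p, hp⟩ using 1
  ext q
  exact radialExt_of_ne (hne q)

theorem SmoothOnSphere.smoothOnPositiveTimes {f : Sphere n → ℝ} (hf : SmoothOnSphere f) :
    SmoothOnPositiveTimes fun _ => f :=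
  (ContMDiff.comp (I' := 𝓡 n) hf contMDiff_snd).contMDiffOn

theorem SmoothOnPositiveTimes.smoothOnSphere {u : ℝ → Sphere n → ℝ} (hu : SmoothOnPositiveTimes u)
    {τ : ℝ} (hτ : 0 < τ) : SmoothOnSphere (u τ) :=
  ContMDiffOn.comp_contMDiff (f := fun x : Sphere n => (τ, x)) (t := Ioi (0 : ℝ) ×ˢ univ) hu
    (contMDiff_const.prodMk contMDiff_id) fun x => ⟨hτ, mem_univ x⟩

theorem SmoothOnSphere.contDiffOn {f : Sphere n → ℝ} (hf : SmoothOnSphere f) :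
    ContDiffOn ℝ ∞ (radialExt f) {0}ᶜ :=
  hf.smoothOnPositiveTimes.contDiffOn.comp (contDiff_prodMk_right 1).contDiffOn
    fun _ hy => ⟨one_pos (α := ℝ), hy⟩

theorem SmoothOnSphere.continuous {f : Sphere n → ℝ} (hf : SmoothOnSphere f) : Continuous f :=
  ContMDiff.continuous hf

theorem contDiffOn_fderiv_apply {E F : Type*} [NormedAddCommGroup E] [NormedSpace ℝ E]
    [NormedAddCommGroup F] [NormedSpace ℝ F] {f : E → F} {s : Set E} (hs : IsOpen s)
    (hf : ContDiffOn ℝ ∞ f s) (e : E) : ContDiffOn ℝ ∞ (fun y => fderiv ℝ f y e) s :=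
  (hf.fderiv_of_isOpen hs (by simp)).clm_apply contDiffOn_const

theorem laplacian_eq_sum_fderiv {E : Type*} [NormedAddCommGroup E] [InnerProductSpace ℝ E]
    [FiniteDimensional ℝ E] {f : E → ℝ} {s : Set E} (hs : IsOpen s)
    (hf : ContDiffOn ℝ ∞ f s) {y : E} (hy : y ∈ s) :
    Laplacian.laplacian f y = ∑ i, fderiv ℝ (fun z => fderiv ℝ f z (stdOrthonormalBasis ℝ E i)) y
      (stdOrthonormalBasis ℝ E i) := by
  rw [InnerProductSpace.laplacian_eq_iteratedFDeriv_stdOrthonormalBasis]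
  refine Finset.sum_congr rfl fun i _ => ?_
  rw [iteratedFDeriv_two_apply]
  have hd : DifferentiableAt ℝ (fderiv ℝ f) y :=
    ((hf.fderiv_of_isOpen (m := ∞) hs (by simp)).contDiffAt (hs.mem_nhds hy)).differentiableAt
      (by simp)
  rw [fderiv_clm_apply hd (differentiableAt_const _)]
  simp

theorem SmoothOnSphere.continuousOn_laplacian {f : Sphere n → ℝ} (hf : SmoothOnSphere f) :
    ContinuousOn (Laplacian.laplacian (radialExt f)) {0}ᶜ := by
  have ho : IsOpen ({0}ᶜ : Set (EuclideanSpace ℝ (Fin (n + 1)))) := isOpen_compl_singleton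
  refine ContinuousOn.congr ?_ fun y hy => laplacian_eq_sum_fderiv ho hf.contDiffOn hy
  exact continuousOn_finsetSum _ fun i _ => (contDiffOn_fderiv_apply ho
    (contDiffOn_fderiv_apply ho hf.contDiffOn _) _).continuousOn

theorem SmoothOnSphere.continuous_sphereLaplacian {f : Sphere n → ℝ} (hf : SmoothOnSphere f) :
    Continuous (sphereLaplacian f) :=
  hf.continuousOn_laplacian.comp_continuous continuous_subtype_val sphere_ne_zero

/-- Euler's identity for a function which is constant along rays. -/
theorem SmoothOnSphere.fderiv_radialExt_self {f : Sphere n → ℝ} (hf : SmoothOnSphere f)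
    {y : EuclideanSpace ℝ (Fin (n + 1))} (hy : y ≠ 0) : fderiv ℝ (radialExt f) y y = 0 := by
  have hd : HasFDerivAt (radialExt f) (fderiv ℝ (radialExt f) y) ((1 : ℝ) • y) := by
    rw [one_smul]
    exact ((hf.contDiffOn.contDiffAt (isOpen_compl_singleton.mem_nhds hy)).differentiableAt
      (by simp)).hasFDerivAt
  have h1 : HasDerivAt (fun t : ℝ => t • y) ((1 : ℝ) • y) 1 := (hasDerivAt_id' 1).smul_const y
  have h2 := hd.comp_hasDerivAt (1 : ℝ) h1
  have h3 : HasDerivAt (radialExt f ∘ fun t : ℝ => t • y) 0 1 := by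
    refine (hasDerivAt_const (1 : ℝ) (radialExt f y)).congr_of_eventuallyEq ?_
    filter_upwards [lt_mem_nhds (one_pos : (0 : ℝ) < 1)] with t ht
    exact radialExt_smul f ht y
  simpa using h2.unique h3

/-- Second derivatives of a function homogeneous of degree zero are homogeneous of degree `-2`. The
chain rule for a dilation by a nonzero constant holds without differentiability, hence for every
`f`. -/
theorem laplacian_radialExt_smul (f : Sphere n → ℝ) {c : ℝ} (hc : 0 < c)
    (y : EuclideanSpace ℝ (Fin (n + 1))) :
    Laplacian.laplacian (radialExt f) y = c ^ 2 * Laplacian.laplacian (radialExt f) (c • y) := by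
  have h1 : ∀ z, fderiv ℝ (radialExt f) z = c • fderiv ℝ (radialExt f) (c • z) := by
    intro z
    rw [← fderiv_comp_smul]
    congr 1
    ext w
    exact (radialExt_smul f hc w).symm
  have h2 : fderiv ℝ (fderiv ℝ (radialExt f)) y =
      c • c • fderiv ℝ (fderiv ℝ (radialExt f)) (c • y) := by
    conv_lhs => rw [funext h1]
    have := fderiv_comp_smul (f := fun z => c • fderiv ℝ (radialExt f) z) (x := y) c
    rw [this]
    congr 1
    have := invertibleOfNonzero hc.ne'
    exact fderiv_const_smul_of_invertible (𝕜 := ℝ) (f := fderiv ℝ (radialExt f)) c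
  simp only [InnerProductSpace.laplacian_eq_iteratedFDeriv_stdOrthonormalBasis, Finset.mul_sum,
    iteratedFDeriv_two_apply]
  refine Finset.sum_congr rfl fun i _ => ?_
  rw [h2]
  simp
  ring

theorem laplacian_radialExt_eq (f : Sphere n → ℝ) {y : EuclideanSpace ℝ (Fin (n + 1))}
    (hy : y ≠ 0) : Laplacian.laplacian (radialExt f) y =
      (‖y‖ ^ 2)⁻¹ * radialExt (sphereLaplacian f) y := by
  rw [laplacian_radialExt_smul f (inv_pos.2 (norm_pos_iff.2 hy)) y, radialExt_of_ne hy, inv_pow]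
  rfl

end ModelScattering

end

noncomputable section

namespace ModelScattering

variable {n : ℕ}

instance : IsFiniteMeasure (surfaceMeasure n) := by
  unfold surfaceMeasure; infer_instance

/-! ### Green's formula on the sphere -/

/-- A bump function of the squared radius. -/
def radialBump : ContDiffBump (1 : ℝ) := ⟨1 / 4, 1 / 2, by norm_num, by norm_num⟩

/-- A smooth radial cutoff supported in an annulus. -/
def annulusCutoff (y : EuclideanSpace ℝ (Fin (n + 1))) : ℝ := radialBump (‖y‖ ^ 2)

theorem contDiff_annulusCutoff : ContDiff ℝ ∞ (annulusCutoff (n := n)) :=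
  radialBump.contDiff.comp (contDiff_norm_sq ℝ)

theorem annulusCutoff_eq_zero {y : EuclideanSpace ℝ (Fin (n + 1))} (hy : ‖y‖ ^ 2 ≤ 1 / 2) :
    annulusCutoff y = 0 := by
  apply radialBump.zero_of_le_dist
  rw [Real.dist_eq, abs_sub_comm]
  refine le_trans ?_ (le_abs_self _)
  simp only [radialBump]
  linarith

theorem annulusCutoff_eventuallyEq_zero :
    annulusCutoff =ᶠ[𝓝 (0 : EuclideanSpace ℝ (Fin (n + 1)))] 0 := by
  have : Tendsto (fun y : EuclideanSpace ℝ (Fin (n + 1)) => ‖y‖ ^ 2) (𝓝 0) (𝓝 0) := by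
    have h : Continuous fun y : EuclideanSpace ℝ (Fin (n + 1)) => ‖y‖ ^ 2 := by fun_prop
    simpa using h.tendsto 0
  filter_upwards [this.eventually_le_const (by norm_num : (0 : ℝ) < 1 / 2)] with y hy
  exact annulusCutoff_eq_zero hy

theorem hasCompactSupport_annulusCutoff :
    HasCompactSupport (annulusCutoff (n := n)) := by
  refine HasCompactSupport.intro (isCompact_closedBall 0 2) fun y hy => ?_
  apply radialBump.zero_of_le_dist
  rw [Metric.mem_closedBall, dist_zero_right, not_le] at hy
  rw [Real.dist_eq]
  refine le_trans ?_ (le_abs_self _)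
  simp only [radialBump]
  nlinarith

theorem fderiv_annulusCutoff (y e : EuclideanSpace ℝ (Fin (n + 1))) :
    fderiv ℝ annulusCutoff y e = 2 * deriv radialBump (‖y‖ ^ 2) * inner ℝ y e := by
  have h1 : HasDerivAt radialBump (deriv radialBump (‖y‖ ^ 2)) (‖y‖ ^ 2) :=
    ((radialBump.contDiff (n := 1)).differentiable (by simp) _).hasDerivAt
  have h2 := h1.comp_hasFDerivAt y (hasStrictFDerivAt_norm_sq y).hasFDerivAt
  have h3 : fderiv ℝ annulusCutoff y = _ := h2.fderiv
  rw [h3]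
  simp
  ring

/-- The cutoff extends functions which are smooth away from the origin. -/
theorem contDiff_annulusCutoff_mul {K : EuclideanSpace ℝ (Fin (n + 1)) → ℝ}
    (hK : ContDiffOn ℝ ∞ K {0}ᶜ) : ContDiff ℝ ∞ (fun y => annulusCutoff y * K y) := by
  rw [contDiff_iff_contDiffAt]
  intro y
  by_cases hy : y = 0
  · subst hy
    refine contDiffAt_const (c := (0 : ℝ)) |>.congr_of_eventuallyEq ?_
    filter_upwards [annulusCutoff_eventuallyEq_zero] with y hy
    simp [hy]
  · exact contDiff_annulusCutoff.contDiffAt.mul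
      (hK.contDiffAt (isOpen_compl_singleton.mem_nhds hy))

theorem integral_fderiv_eq_zero {E : Type*} [NormedAddCommGroup E] [NormedSpace ℝ E]
    [FiniteDimensional ℝ E] [MeasurableSpace E] [BorelSpace E] (μ : Measure E) [μ.IsAddHaarMeasure]
    {H : E → ℝ} (hH : ContDiff ℝ ∞ H) (hc : HasCompactSupport H) (e : E) :
    Integrable (fun y => fderiv ℝ H y e) μ ∧ ∫ y, fderiv ℝ H y e ∂μ = 0 := by
  have h1 : Integrable (fun y => fderiv ℝ H y e) μ :=
    Continuous.integrable_of_hasCompactSupport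
      ((hH.continuous_fderiv (by simp)).clm_apply continuous_const) (hc.fderiv_apply ℝ e)
  -- Integration by parts against the constant `1`; only the products have to be integrable.
  have h2 := integral_mul_fderiv_eq_neg_fderiv_mul_of_integrable (μ := μ) (𝕜 := ℝ)
    (f := fun _ : E => (1 : ℝ)) (g := H) (v := e) (by simp) (by simpa using h1)
    (by simpa using hH.continuous.integrable_of_hasCompactSupport hc)
    (fun x _ => differentiableAt_const _) (fun x _ => hH.differentiable (by simp) x)
  exact ⟨h1, by simpa using h2⟩

/-- Divergence theorem for the compactly supported field `ζ (G ∇F - F ∇G)`, with `ζ` the cutoff. The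
gradient of `ζ` is radial while `F` and `G` are constant along rays, so by Euler's identity
differentiating the cutoff contributes nothing. -/
theorem integral_annulusCutoff_mul {f g : Sphere n → ℝ} (hf : SmoothOnSphere f)
    (hg : SmoothOnSphere g) :
    ∫ y : EuclideanSpace ℝ (Fin (n + 1)), annulusCutoff y *
      (radialExt g y * Laplacian.laplacian (radialExt f) y
        - radialExt f y * Laplacian.laplacian (radialExt g) y) = 0 := by
  set F := radialExt f with hF
  set G := radialExt g with hG
  have ho : IsOpen ({0}ᶜ : Set (EuclideanSpace ℝ (Fin (n + 1)))) := isOpen_compl_singleton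
  have hFs : ContDiffOn ℝ ∞ F {0}ᶜ := hf.contDiffOn
  have hGs : ContDiffOn ℝ ∞ G {0}ᶜ := hg.contDiffOn
  let b := stdOrthonormalBasis ℝ (EuclideanSpace ℝ (Fin (n + 1)))
  let K := fun i y => G y * fderiv ℝ F y (b i) - F y * fderiv ℝ G y (b i)
  have hK : ∀ i, ContDiffOn ℝ ∞ (K i) {0}ᶜ := fun i =>
    (hGs.mul (contDiffOn_fderiv_apply ho hFs _)).sub (hFs.mul (contDiffOn_fderiv_apply ho hGs _))
  have hI := fun i => integral_fderiv_eq_zero (volume : Measure (EuclideanSpace ℝ (Fin (n + 1))))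
    (contDiff_annulusCutoff_mul (hK i))
    (hasCompactSupport_annulusCutoff.mul_right (f' := K i)) (b i)
  rw [← Finset.sum_eq_zero fun i _ => (hI i).2, ← integral_finsetSum _ fun i _ => (hI i).1]
  congr 1
  ext y
  by_cases hy : y = 0
  · subst hy
    have h0 : ∀ i, fderiv ℝ (fun y => annulusCutoff y * K i y) 0 = 0 := by
      intro i
      have : (fun y => annulusCutoff y * K i y) =ᶠ[𝓝 0] fun _ => 0 := by
        filter_upwards [annulusCutoff_eventuallyEq_zero] with y hy
        simp [hy]
      rw [this.fderiv_eq, fderiv_fun_const]; rfl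
    simp [h0, annulusCutoff_eventuallyEq_zero.eq_of_nhds]
  · have hd : ∀ {k : EuclideanSpace ℝ (Fin (n + 1)) → ℝ}, ContDiffOn ℝ ∞ k {0}ᶜ →
        DifferentiableAt ℝ k y := fun hk =>
      (hk.contDiffAt (ho.mem_nhds hy)).differentiableAt (by simp)
    have hterm : ∀ i, fderiv ℝ (fun y => annulusCutoff y * K i y) y (b i) =
        annulusCutoff y * (G y * fderiv ℝ (fun z => fderiv ℝ F z (b i)) y (b i)
          - F y * fderiv ℝ (fun z => fderiv ℝ G z (b i)) y (b i))
        + 2 * deriv radialBump (‖y‖ ^ 2) * (G y * (inner ℝ y (b i) * fderiv ℝ F y (b i))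
          - F y * (inner ℝ y (b i) * fderiv ℝ G y (b i))) := by
      intro i
      have h1 := (hd hGs).hasFDerivAt.mul (hd (contDiffOn_fderiv_apply ho hFs (b i))).hasFDerivAt
      have h2 := (hd hFs).hasFDerivAt.mul (hd (contDiffOn_fderiv_apply ho hGs (b i))).hasFDerivAt
      have h3 : HasFDerivAt (annulusCutoff (n := n)) (fderiv ℝ annulusCutoff y) y :=
        (contDiff_annulusCutoff.differentiable (by simp) y).hasFDerivAt
      have h4 : fderiv ℝ (fun y => annulusCutoff y * K i y) y = _ := (h3.mul (h1.sub h2)).fderiv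
      rw [h4]
      simp only [_root_.add_apply, _root_.smul_apply, _root_.sub_apply, fderiv_annulusCutoff, smul_eq_mul, Pi.sub_apply,
        Pi.mul_apply]
      ring
    have heuler : ∀ k : EuclideanSpace ℝ (Fin (n + 1)) → ℝ,
        ∑ i, inner ℝ y (b i) * fderiv ℝ k y (b i) = fderiv ℝ k y y := by
      intro k
      have := congrArg (fderiv ℝ k y) (b.sum_repr' y)
      simpa only [map_sum, map_smul, smul_eq_mul, real_inner_comm y] using this
    simp only [hterm]
    rw [Finset.sum_add_distrib, ← Finset.mul_sum, ← Finset.mul_sum, Finset.sum_sub_distrib,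
      Finset.sum_sub_distrib, ← Finset.mul_sum, ← Finset.mul_sum, ← Finset.mul_sum,
      ← Finset.mul_sum, heuler, heuler, hf.fderiv_radialExt_self hy, hg.fderiv_radialExt_self hy,
      ← laplacian_eq_sum_fderiv ho hFs hy, ← laplacian_eq_sum_fderiv ho hGs hy]
    ring

theorem integral_polar (w : ℝ → ℝ) (k : Sphere n → ℝ) :
    ∫ y : EuclideanSpace ℝ (Fin (n + 1)), radialExt k y * w ‖y‖ =
      (∫ x, k x ∂surfaceMeasure n) * ∫ r : Ioi (0 : ℝ), w r ∂Measure.volumeIoiPow n := by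
  have h1 : ∫ y : EuclideanSpace ℝ (Fin (n + 1)), radialExt k y * w ‖y‖ =
      ∫ y : ({0}ᶜ : Set (EuclideanSpace ℝ (Fin (n + 1)))), radialExt k y.1 * w ‖y.1‖
        ∂(volume.comap Subtype.val) := by
    rw [integral_subtype_comap (measurableSet_singleton _).compl
      fun y : EuclideanSpace ℝ (Fin (n + 1)) => radialExt k y * w ‖y‖,
      restrict_compl_singleton]
  have h2 := (volume : Measure (EuclideanSpace ℝ (Fin (n + 1)))
    ).measurePreserving_homeomorphUnitSphereProd.integral_comp
      (Homeomorph.measurableEmbedding _) (fun p => k p.1 * w p.2)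
  rw [integral_prod_mul (f := k) (g := fun r : Ioi (0 : ℝ) => w r)] at h2
  rw [h1]
  have h3 : Module.finrank ℝ (EuclideanSpace ℝ (Fin (n + 1))) - 1 = n := by simp
  rw [h3] at h2
  rw [surfaceMeasure, ← h2]
  congr 1
  ext y
  have h4 : radialProj y.1 y.2 = (homeomorphUnitSphereProd _ y).1 := by
    ext1
    rw [homeomorphUnitSphereProd_apply_fst_coe]
    rfl
  rw [radialExt_of_ne y.2, h4, homeomorphUnitSphereProd_apply_snd_coe]

/-- Off the origin, the Euclidean Laplacian of a radial extension is `|y|⁻²` times the extension of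
the spherical one. In polar coordinates the annulus identity therefore factors into the desired
integral over the sphere and a nonzero radial integral. -/
theorem integral_sphereLaplacian_mul {f g : Sphere n → ℝ} (hf : SmoothOnSphere f)
    (hg : SmoothOnSphere g) :
    ∫ x, sphereLaplacian f x * g x ∂surfaceMeasure n =
      ∫ x, f x * sphereLaplacian g x ∂surfaceMeasure n := by
  have h1 := integral_annulusCutoff_mul hf hg
  let w : ℝ → ℝ := fun r => radialBump (r ^ 2) * (r ^ 2)⁻¹
  have h2 := integral_polar w fun x => sphereLaplacian f x * g x - f x * sphereLaplacian g x
  have h3 : ∀ y : EuclideanSpace ℝ (Fin (n + 1)),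
      radialExt (fun x => sphereLaplacian f x * g x - f x * sphereLaplacian g x) y * w ‖y‖ =
      annulusCutoff y * (radialExt g y * Laplacian.laplacian (radialExt f) y
        - radialExt f y * Laplacian.laplacian (radialExt g) y) := by
    intro y
    by_cases hy : y = 0
    · subst hy
      simp [annulusCutoff_eventuallyEq_zero.eq_of_nhds, radialExt]
    · rw [laplacian_radialExt_eq f hy, laplacian_radialExt_eq g hy]
      simp only [radialExt_of_ne hy, w, annulusCutoff]
      ring
  rw [integral_congr_ae (ae_of_all _ h3), h1] at h2
  -- Were the radial factor zero, the polar formula for the constant `1` would make the integral of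
  -- a nonnegative continuous function, positive on the unit sphere, vanish.
  have h4 : (∫ r : Ioi (0 : ℝ), w r ∂Measure.volumeIoiPow n) ≠ 0 := by
    intro h0
    have h5 := integral_polar (n := n) w fun _ => 1
    rw [h0, mul_zero] at h5
    have hw : ∀ y : EuclideanSpace ℝ (Fin (n + 1)), radialExt (fun _ => 1) y * w ‖y‖ =
        annulusCutoff y * (‖y‖ ^ 2)⁻¹ := by
      intro y
      by_cases hy : y = 0
      · subst hy
        simp [annulusCutoff_eventuallyEq_zero.eq_of_nhds, radialExt]
      · simp [radialExt_of_ne hy, w, annulusCutoff]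
    rw [integral_congr_ae (ae_of_all _ hw)] at h5
    have hs : ContDiffOn ℝ ∞ (fun y : EuclideanSpace ℝ (Fin (n + 1)) => (‖y‖ ^ 2)⁻¹) {0}ᶜ :=
      (contDiff_norm_sq ℝ).contDiffOn.inv fun y hy => by
        have : y ≠ 0 := hy
        positivity
    obtain ⟨x⟩ : Nonempty (Sphere n) :=
      (NormedSpace.sphere_nonempty.2 zero_le_one).to_subtype
    have hpos := Continuous.integral_pos_of_hasCompactSupport_nonneg_nonzero
      (μ := (volume : Measure (EuclideanSpace ℝ (Fin (n + 1))))) (x := (x : EuclideanSpace ℝ _))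
      (contDiff_annulusCutoff_mul hs).continuous hasCompactSupport_annulusCutoff.mul_right
      (fun y => mul_nonneg radialBump.nonneg (by positivity)) ?_
    · exact hpos.ne' h5
    · have : annulusCutoff (x : EuclideanSpace ℝ (Fin (n + 1))) = 1 := by
        apply radialBump.one_of_mem_closedBall
        simp [radialBump]
      rw [this]
      simp
  have h5 := (mul_eq_zero.1 h2.symm).resolve_right h4
  have hint : ∀ {k : Sphere n → ℝ}, Continuous k → Integrable k (surfaceMeasure n) := fun hk =>
    hk.integrable_of_hasCompactSupport (HasCompactSupport.of_compactSpace _)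
  have h6 : Integrable (fun x => sphereLaplacian f x * g x) (surfaceMeasure n) :=
    hint (hf.continuous_sphereLaplacian.mul hg.continuous)
  have h7 : Integrable (fun x => f x * sphereLaplacian g x) (surfaceMeasure n) :=
    hint (hf.continuous.mul hg.continuous_sphereLaplacian)
  rw [integral_sub h6 h7] at h5
  linarith

end ModelScattering

end

noncomputable section

namespace ModelScattering

variable {n : ℕ}

/-! ### Coefficients of a solution along an eigenfunction -/

theorem integrable_of_continuous {k : Sphere n → ℝ} (hk : Continuous k) :
    Integrable k (surfaceMeasure n) :=
  hk.integrable_of_hasCompactSupport (HasCompactSupport.of_compactSpace _)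

theorem SmoothOnPositiveTimes.hasDerivAt {u : ℝ → Sphere n → ℝ} (hu : SmoothOnPositiveTimes u)
    {τ : ℝ} (hτ : 0 < τ) (x : Sphere n) :
    HasDerivAt (fun σ => u σ x) (fderiv ℝ (fun p : ℝ × EuclideanSpace ℝ (Fin (n + 1)) =>
      radialExt (u p.1) p.2) (τ, x) (1, 0)) τ := by
  have ho : IsOpen (Ioi (0 : ℝ) ×ˢ ({0}ᶜ : Set (EuclideanSpace ℝ (Fin (n + 1))))) :=
    isOpen_Ioi.prod isOpen_compl_singleton
  have hd : HasFDerivAt (fun p : ℝ × EuclideanSpace ℝ (Fin (n + 1)) => radialExt (u p.1) p.2)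
      _ (τ, (x : EuclideanSpace ℝ (Fin (n + 1)))) :=
    ((hu.contDiffOn.contDiffAt (ho.mem_nhds (mk_mem_prod hτ (sphere_ne_zero x)))).differentiableAt
      (by simp)).hasFDerivAt
  have h1 : HasDerivAt (fun σ : ℝ => (σ, (x : EuclideanSpace ℝ (Fin (n + 1))))) (1, 0) τ :=
    (hasDerivAt_id' τ).prodMk (hasDerivAt_const τ _)
  have h2 := hd.comp_hasDerivAt τ h1
  simpa [Function.comp_def] using h2

theorem SmoothOnPositiveTimes.hasDerivAt_timeDeriv {u : ℝ → Sphere n → ℝ}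
    (hu : SmoothOnPositiveTimes u) {τ : ℝ} (hτ : 0 < τ) (x : Sphere n) :
    HasDerivAt (fun σ => u σ x) (timeDeriv u τ x) τ :=
  (hu.hasDerivAt hτ x).differentiableAt.hasDerivAt

/-- The time derivative is the derivative of the radial extension in the direction `(1, 0)`,
restricted to the sphere, so its smoothness is a Euclidean fact. -/
theorem SmoothOnPositiveTimes.timeDeriv {u : ℝ → Sphere n → ℝ} (hu : SmoothOnPositiveTimes u) :
    SmoothOnPositiveTimes (timeDeriv u) := by
  have : Fact (Module.finrank ℝ (EuclideanSpace ℝ (Fin (n + 1))) = n + 1) := ⟨by simp⟩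
  have ho : IsOpen (Ioi (0 : ℝ) ×ˢ ({0}ᶜ : Set (EuclideanSpace ℝ (Fin (n + 1))))) :=
    isOpen_Ioi.prod isOpen_compl_singleton
  have h1 := (contDiffOn_fderiv_apply ho hu.contDiffOn (1, 0)).contMDiffOn
  have h2 : ContMDiff (𝓘(ℝ, ℝ).prod (𝓡 n)) 𝓘(ℝ, ℝ × EuclideanSpace ℝ (Fin (n + 1))) ∞
      (fun p : ℝ × Sphere n => (p.1, (p.2 : EuclideanSpace ℝ (Fin (n + 1))))) :=
    contMDiff_fst.prodMk_space (contMDiff_coe_sphere.comp contMDiff_snd)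
  refine ContMDiffOn.congr (h1.comp h2.contMDiffOn (s := Ioi (0 : ℝ) ×ˢ univ) ?_) ?_
  · exact fun p hp => ⟨hp.1, sphere_ne_zero p.2⟩
  · exact fun p hp => (hu.hasDerivAt hp.1 p.2).deriv

theorem SmoothOnPositiveTimes.continuous {u : ℝ → Sphere n → ℝ} (hu : SmoothOnPositiveTimes u)
    {τ : ℝ} (hτ : 0 < τ) : Continuous (u τ) :=
  (hu.smoothOnSphere hτ).continuous

theorem SmoothOnPositiveTimes.hasDerivAt_integral {u : ℝ → Sphere n → ℝ}
    (hu : SmoothOnPositiveTimes u) {φ : Sphere n → ℝ} (hφ : Continuous φ) {τ : ℝ} (hτ : 0 < τ) :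
    HasDerivAt (fun σ => ∫ x, u σ x * φ x ∂surfaceMeasure n)
      (∫ x, ModelScattering.timeDeriv u τ x * φ x ∂surfaceMeasure n) τ := by
  have hc : ContinuousOn (fun p : ℝ × Sphere n => ModelScattering.timeDeriv u p.1 p.2 * φ p.2)
      (Icc (τ / 2) (2 * τ) ×ˢ univ) := by
    refine ContinuousOn.mul (hu.timeDeriv.continuousOn.mono ?_)
      (hφ.comp continuous_snd).continuousOn
    exact prod_mono_left fun σ hσ => (half_pos hτ).trans_le hσ.1
  obtain ⟨C, hC⟩ := (isCompact_Icc.prod isCompact_univ).exists_bound_of_continuousOn hc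
  refine (hasDerivAt_integral_of_dominated_loc_of_deriv_le (bound := fun _ => C)
    (s := Icc (τ / 2) (2 * τ)) (F := fun σ x => u σ x * φ x)
    (F' := fun σ x => ModelScattering.timeDeriv u σ x * φ x) ?_ ?_ ?_ ?_ ?_ ?_ ?_).2
  · exact Icc_mem_nhds (by linarith) (by linarith)
  · filter_upwards [lt_mem_nhds hτ] with σ hσ
    exact ((hu.continuous hσ).mul hφ).aestronglyMeasurable
  · exact integrable_of_continuous ((hu.continuous hτ).mul hφ)
  · exact ((hu.timeDeriv.continuous hτ).mul hφ).aestronglyMeasurable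
  · exact ae_of_all _ fun x σ hσ => hC (σ, x) ⟨hσ, mem_univ x⟩
  · exact integrable_const C
  · exact ae_of_all _ fun x σ hσ =>
      (hu.hasDerivAt_timeDeriv ((half_pos hτ).trans_le hσ.1) x).mul_const (φ x)

variable {q' B : ℝ} {f₁ f₂ f₃ : ℝ → ℝ} {α χ : ℝ → Sphere n → ℝ} {χ₀ O h : Sphere n → ℝ}

theorem IsEigenfunction.integral_sphereLaplacian_mul {lam : ℝ≥0} {φ f : Sphere n → ℝ}
    (hφ : IsEigenfunction lam φ) (hf : SmoothOnSphere f) :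
    ∫ x, sphereLaplacian f x * φ x ∂surfaceMeasure n =
      -((lam : ℝ) ^ 2 * ∫ x, f x * φ x ∂surfaceMeasure n) := by
  rw [ModelScattering.integral_sphereLaplacian_mul hf hφ.1, ← integral_const_mul, ← integral_neg]
  congr 1
  ext x
  have := hφ.2 x
  linear_combination -(f x) * this

theorem abs_le_of_abs_add_le {a b c B : ℝ} (h : |a| + |b| + |c| ≤ B) :
    0 ≤ B ∧ |a| ≤ B ∧ |b| ≤ B ∧ |c| ≤ B := by
  have h1 := abs_nonneg a
  have h2 := abs_nonneg b
  have h3 := abs_nonneg c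
  refine ⟨?_, ?_, ?_, ?_⟩ <;> linarith

theorem IsSmoothSolution.isModeSolution (hs : IsSmoothSolution q' f₁ f₂ f₃ α χ χ₀ O h)
    (hf : ∀ τ > 0, |f₁ τ| + |f₂ τ| + |f₃ τ| ≤ B) {lam : ℝ≥0} {φ : Sphere n → ℝ}
    (hφ : IsEigenfunction lam φ) :
    IsModeSolution q' B lam (fun τ => ∫ x, α τ x * φ x ∂surfaceMeasure n)
      (fun τ => ∫ x, timeDeriv α τ x * φ x ∂surfaceMeasure n)
      (fun τ => ∫ x, χ τ x * φ x ∂surfaceMeasure n) where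
  deriv_a τ hτ := hs.smooth_alpha.hasDerivAt_integral hφ.1.continuous hτ
  deriv_x τ hτ := by
    convert! hs.smooth_chi.hasDerivAt_integral hφ.1.continuous hτ using 1
    rw [← integral_const_mul]
    congr 1
    ext x
    rw [hs.chi_eq τ hτ x]
    ring
  deriv_a₁ τ hτ := by
    have hφc := hφ.1.continuous
    have hα := hs.smooth_alpha
    refine ⟨f₁ τ * (τ * ∫ x, timeDeriv α τ x * φ x ∂surfaceMeasure n)
      + f₂ τ * (τ ^ 2 * ∫ x, α τ x * φ x ∂surfaceMeasure n)
      + f₃ τ * ∫ x, χ τ x * φ x ∂surfaceMeasure n, ?_, ?_⟩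
    · obtain ⟨-, h1, h2, h3⟩ := abs_le_of_abs_add_le (hf τ hτ)
      refine (abs_add_three _ _ _).trans ?_
      simp only [abs_mul, abs_of_pos hτ, abs_of_pos (pow_pos hτ 2)]
      rw [mul_add, mul_add]
      gcongr
    · convert! hα.timeDeriv.hasDerivAt_integral hφc hτ using 1
      have e1 := hφ.integral_sphereLaplacian_mul (hα.smoothOnSphere hτ)
      have i0 : Integrable (fun x => α τ x * φ x) (surfaceMeasure n) :=
        integrable_of_continuous ((hα.continuous hτ).mul hφc)
      have i1 : Integrable (fun x => timeDeriv α τ x * φ x) (surfaceMeasure n) :=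
        integrable_of_continuous ((hα.timeDeriv.continuous hτ).mul hφc)
      have i2 : Integrable (fun x => χ τ x * φ x) (surfaceMeasure n) :=
        integrable_of_continuous ((hs.smooth_chi.continuous hτ).mul hφc)
      have i3 : Integrable (fun x => sphereLaplacian (α τ) x * φ x) (surfaceMeasure n) :=
        integrable_of_continuous ((hα.smoothOnSphere hτ).continuous_sphereLaplacian.mul hφc)
      have e2 : ∀ x, timeDeriv (timeDeriv α) τ x * φ x =
          (f₁ τ * τ - 1 / τ) * (timeDeriv α τ x * φ x)
          + (f₂ τ * τ ^ 2 - 4 * q') * (α τ x * φ x) + f₃ τ * (χ τ x * φ x)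
          + 4 / (τ ^ 2 + 1) ^ 2 * (sphereLaplacian (α τ) x * φ x) := fun x => by
        linear_combination φ x * hs.alpha_eq τ hτ x
      have i4 : Integrable (fun x => (f₁ τ * τ - 1 / τ) * (timeDeriv α τ x * φ x)
          + (f₂ τ * τ ^ 2 - 4 * q') * (α τ x * φ x)) (surfaceMeasure n) :=
        (i1.const_mul _).add (i0.const_mul _)
      have i5 : Integrable (fun x => (f₁ τ * τ - 1 / τ) * (timeDeriv α τ x * φ x)
          + (f₂ τ * τ ^ 2 - 4 * q') * (α τ x * φ x) + f₃ τ * (χ τ x * φ x)) (surfaceMeasure n) :=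
        i4.add (i2.const_mul _)
      rw [integral_congr_ae (ae_of_all _ e2), integral_add i5 (i3.const_mul _),
        integral_add i4 (i2.const_mul _), integral_add (i1.const_mul _) (i0.const_mul _),
        integral_const_mul, integral_const_mul, integral_const_mul, integral_const_mul, e1]
      ring

theorem IsBigOInSmooth.integral_mul {u : ℝ → Sphere n → ℝ} {g : ℝ → ℝ} (hu : IsBigOInSmooth u g)
    {φ : Sphere n → ℝ} (hφ : Continuous φ) :
    ∃ C : ℝ, ∀ᶠ τ in 𝓝[>] (0 : ℝ), |∫ x, u τ x * φ x ∂surfaceMeasure n| ≤ C * |g τ| := by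
  obtain ⟨C, hC⟩ := hu 0
  obtain ⟨M, hM⟩ := isCompact_univ.exists_bound_of_continuousOn hφ.continuousOn
  refine ⟨C * M * (surfaceMeasure n).real univ, ?_⟩
  filter_upwards [hC] with τ hτ
  have : ∀ x, ‖u τ x * φ x‖ ≤ C * |g τ| * M := fun x => by
    have h1 := hτ x
    rw [norm_iteratedFDeriv_zero, radialExt_coe] at h1
    rw [norm_mul]
    exact mul_le_mul h1 (hM x (mem_univ x)) (norm_nonneg _) ((norm_nonneg _).trans h1)
  refine (norm_integral_le_of_norm_le_const (ae_of_all _ this)).trans_eq ?_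
  ring

theorem tendsto_sq_mul_log_pow :
    Tendsto (fun τ : ℝ => τ ^ 2 * |Real.log τ| ^ 2) (𝓝[>] 0) (𝓝 0) ∧
      Tendsto (fun τ : ℝ => τ ^ 2 * |Real.log τ| ^ 3) (𝓝[>] 0) (𝓝 0) := by
  have h1 : Tendsto (fun τ : ℝ => |Real.log τ * τ ^ (1 / 2 : ℝ)|) (𝓝[>] 0) (𝓝 0) := by
    simpa using (tendsto_log_mul_rpow_nhdsGT_zero (by norm_num : (0 : ℝ) < 1 / 2)).abs
  have h2 : Tendsto (fun τ : ℝ => √τ) (𝓝[>] 0) (𝓝 0) := by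
    have := (Real.continuous_sqrt.tendsto 0).mono_left (nhdsWithin_le_nhds (s := Ioi (0 : ℝ)))
    simpa using this
  have h3 : ∀ τ > 0, τ ^ 2 = √τ ^ 4 := fun τ hτ => by
    calc τ ^ 2 = (√τ ^ 2) ^ 2 := by rw [Real.sq_sqrt (le_of_lt hτ)]
      _ = _ := by ring
  constructor
  · have h4 := (h1.pow 2).mul (h2.pow 2)
    rw [zero_pow two_ne_zero, mul_zero] at h4
    refine h4.congr' ?_
    filter_upwards [self_mem_nhdsWithin] with τ hτ
    rw [← Real.sqrt_eq_rpow, abs_mul, abs_of_nonneg (Real.sqrt_nonneg τ), h3 τ hτ]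
    ring
  · have h4 := (h1.pow 3).mul h2
    rw [mul_zero] at h4
    refine h4.congr' ?_
    filter_upwards [self_mem_nhdsWithin] with τ hτ
    rw [← Real.sqrt_eq_rpow, abs_mul, abs_of_nonneg (Real.sqrt_nonneg τ), h3 τ hτ]
    ring

/-- Replacing `𝒪 log τ` by `τ ∂_τ α log τ` multiplies the error of the derivative expansion by `τ
|log τ|`. The total error is of order `τ² |log τ|³`, which still tends to zero. -/
theorem IsSmoothSolution.tendsto_alpha (hs : IsSmoothSolution q' f₁ f₂ f₃ α χ χ₀ O h)
    {φ : Sphere n → ℝ} (hφ : Continuous φ) :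
    Tendsto (fun τ => τ * ∫ x, timeDeriv α τ x * φ x ∂surfaceMeasure n) (𝓝[>] 0)
      (𝓝 (∫ x, O x * φ x ∂surfaceMeasure n)) ∧
    Tendsto (fun τ => (∫ x, α τ x * φ x ∂surfaceMeasure n)
      - τ * (∫ x, timeDeriv α τ x * φ x ∂surfaceMeasure n) * Real.log τ) (𝓝[>] 0)
      (𝓝 (∫ x, h x * φ x ∂surfaceMeasure n)) := by
  obtain ⟨C₁, hC₁⟩ := hs.alpha_expansion.integral_mul hφ
  obtain ⟨C₂, hC₂⟩ := hs.deriv_alpha_expansion.integral_mul hφ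
  set o := ∫ x, O x * φ x ∂surfaceMeasure n with ho
  set k := ∫ x, h x * φ x ∂surfaceMeasure n with hk
  have iO : Integrable (fun x => O x * φ x) (surfaceMeasure n) :=
    integrable_of_continuous (hs.smooth_O.continuous.mul hφ)
  have ih : Integrable (fun x => h x * φ x) (surfaceMeasure n) :=
    integrable_of_continuous (hs.smooth_h.continuous.mul hφ)
  have e1 : ∀ τ > 0, ∫ x, (α τ x - (O x * Real.log τ + h x)) * φ x ∂surfaceMeasure n =
      (∫ x, α τ x * φ x ∂surfaceMeasure n) - (o * Real.log τ + k) := by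
    intro τ hτ
    have i0 : Integrable (fun x => α τ x * φ x) (surfaceMeasure n) :=
      integrable_of_continuous ((hs.smooth_alpha.continuous hτ).mul hφ)
    have i1 : Integrable (fun x => O x * φ x * Real.log τ + h x * φ x) (surfaceMeasure n) :=
      (iO.mul_const _).add ih
    rw [ho, hk, ← integral_mul_const, ← integral_add (iO.mul_const _) ih, ← integral_sub i0 i1]
    congr 1
    ext x
    ring
  have e2 : ∀ τ > 0, ∫ x, (timeDeriv α τ x - O x / τ) * φ x ∂surfaceMeasure n =
      (∫ x, timeDeriv α τ x * φ x ∂surfaceMeasure n) - o / τ := by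
    intro τ hτ
    have i0 : Integrable (fun x => timeDeriv α τ x * φ x) (surfaceMeasure n) :=
      integrable_of_continuous ((hs.smooth_alpha.timeDeriv.continuous hτ).mul hφ)
    rw [ho, ← integral_div, ← integral_sub i0 (iO.div_const _)]
    congr 1
    ext x
    ring
  obtain ⟨l2, l3⟩ := tendsto_sq_mul_log_pow
  have b2 : ∀ᶠ τ in 𝓝[>] (0 : ℝ), |τ * (∫ x, timeDeriv α τ x * φ x ∂surfaceMeasure n) - o| ≤
      C₂ * (τ ^ 2 * |Real.log τ| ^ 2) := by
    filter_upwards [hC₂, self_mem_nhdsWithin] with τ h1 hτ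
    have hτ' : 0 < τ := hτ
    rw [e2 τ hτ, abs_of_nonneg (by positivity : 0 ≤ τ * |Real.log τ| ^ 2)] at h1
    have h2 : τ * (∫ x, timeDeriv α τ x * φ x ∂surfaceMeasure n) - o =
        τ * ((∫ x, timeDeriv α τ x * φ x ∂surfaceMeasure n) - o / τ) := by
      field_simp
    rw [h2, abs_mul, abs_of_pos hτ']
    refine (mul_le_mul_of_nonneg_left h1 hτ'.le).trans_eq ?_
    ring
  refine ⟨?_, ?_⟩
  · rw [tendsto_iff_norm_sub_tendsto_zero]
    refine squeeze_zero' (Eventually.of_forall fun _ => norm_nonneg _) b2 ?_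
    simpa using l2.const_mul C₂
  · rw [tendsto_iff_norm_sub_tendsto_zero]
    have hlim : Tendsto (fun τ : ℝ => C₁ * (τ ^ 2 * |Real.log τ| ^ 2)
        + C₂ * (τ ^ 2 * |Real.log τ| ^ 3)) (𝓝[>] 0) (𝓝 0) := by
      simpa using (l2.const_mul C₁).add (l3.const_mul C₂)
    refine squeeze_zero' (Eventually.of_forall fun _ => norm_nonneg _) ?_ hlim
    filter_upwards [hC₁, b2, self_mem_nhdsWithin] with τ h1 h2 hτ
    rw [e1 τ hτ, abs_of_nonneg (by positivity : 0 ≤ τ ^ 2 * |Real.log τ| ^ 2)] at h1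
    have h3 : (∫ x, α τ x * φ x ∂surfaceMeasure n)
        - τ * (∫ x, timeDeriv α τ x * φ x ∂surfaceMeasure n) * Real.log τ - k =
        ((∫ x, α τ x * φ x ∂surfaceMeasure n) - (o * Real.log τ + k))
        - (τ * (∫ x, timeDeriv α τ x * φ x ∂surfaceMeasure n) - o) * Real.log τ := by ring
    rw [h3, Real.norm_eq_abs]
    refine (abs_sub _ _).trans (add_le_add h1 ?_)
    rw [abs_mul]
    refine (mul_le_mul_of_nonneg_right h2 (abs_nonneg _)).trans_eq ?_
    ring

theorem IsSmoothSolution.tendsto_chi (hs : IsSmoothSolution q' f₁ f₂ f₃ α χ χ₀ O h)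
    {φ : Sphere n → ℝ} (hφ : Continuous φ) :
    Tendsto (fun τ => ∫ x, χ τ x * φ x ∂surfaceMeasure n) (𝓝[>] 0)
      (𝓝 (∫ x, χ₀ x * φ x ∂surfaceMeasure n)) := by
  obtain ⟨w, hw, hwχ, hw0⟩ := hs.chi_regular
  have h0 := (hw.1 0 self_mem_Ici).2 0
  obtain ⟨M, hM⟩ := isCompact_univ.exists_bound_of_continuousOn hφ.continuousOn
  set V := (surfaceMeasure n).real univ with hV
  have hV0 : 0 ≤ V := measureReal_nonneg
  have hM0 : 0 ≤ |M| := abs_nonneg M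
  rw [Metric.tendsto_nhds]
  intro ε hε
  have hδ : 0 < ε / (|M| * V + 1) := by positivity
  have hev := (Metric.tendstoUniformlyOn_iff.1 h0 _ hδ).filter_mono
    (nhdsWithin_mono 0 Ioi_subset_Ici_self)
  filter_upwards [hev, self_mem_nhdsWithin] with τ h1 hτ
  have h2 : ∀ x, ‖(χ τ x - χ₀ x) * φ x‖ ≤ ε / (|M| * V + 1) * |M| := by
    intro x
    have h3 := (h1 x x.2).le
    rw [dist_comm, dist_eq_norm] at h3
    have h4 := (ContinuousMultilinearMap.le_opNorm
      (iteratedFDeriv ℝ 0 (radialExt (w τ)) (x : EuclideanSpace ℝ (Fin (n + 1)))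
        - iteratedFDeriv ℝ 0 (radialExt (w 0)) (x : EuclideanSpace ℝ (Fin (n + 1)))) 0).trans_eq
      (by simp : _ = ‖iteratedFDeriv ℝ 0 (radialExt (w τ)) (x : EuclideanSpace ℝ (Fin (n + 1)))
        - iteratedFDeriv ℝ 0 (radialExt (w 0)) (x : EuclideanSpace ℝ (Fin (n + 1)))‖)
    rw [_root_.sub_apply, iteratedFDeriv_zero_apply, iteratedFDeriv_zero_apply,
      radialExt_coe, radialExt_coe, hwχ τ hτ x, hw0 x] at h4
    rw [norm_mul]
    exact mul_le_mul (h4.trans h3) ((hM x (mem_univ x)).trans (le_abs_self M)) (norm_nonneg _)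
      hδ.le
  have i1 : Integrable (fun x => χ τ x * φ x) (surfaceMeasure n) :=
    integrable_of_continuous ((hs.smooth_chi.continuous hτ).mul hφ)
  have i2 : Integrable (fun x => χ₀ x * φ x) (surfaceMeasure n) :=
    integrable_of_continuous (hs.smooth_chi_zero.continuous.mul hφ)
  rw [dist_eq_norm, ← integral_sub i1 i2]
  simp only [← sub_mul]
  refine (norm_integral_le_of_norm_le_const (ae_of_all _ h2)).trans_lt ?_
  rw [← hV, mul_assoc, div_mul_eq_mul_div, div_lt_iff₀ (by positivity)]
  exact mul_lt_mul_of_pos_left (lt_add_one _) hε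

end ModelScattering

end

noncomputable section

namespace ModelScattering

variable {n : ℕ}

/-! ### Frequency projections -/

theorem memLp_of_continuous {f : Sphere n → ℝ} (hf : Continuous f) :
    MemLp f 2 (surfaceMeasure n) :=
  hf.memLp_of_hasCompactSupport (HasCompactSupport.of_compactSpace _)

theorem toL2_of_continuous {f : Sphere n → ℝ} (hf : Continuous f) :
    toL2 f = (memLp_of_continuous hf).toLp f := by
  rw [toL2, dif_pos (memLp_of_continuous hf)]

theorem inner_toL2 {f g : Sphere n → ℝ} (hf : Continuous f) (hg : Continuous g) :
    inner ℝ (toL2 f) (toL2 g) = ∫ x, f x * g x ∂surfaceMeasure n := by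
  rw [toL2_of_continuous hf, toL2_of_continuous hg, L2.inner_def]
  refine integral_congr_ae ?_
  filter_upwards [(memLp_of_continuous hf).coeFn_toLp, (memLp_of_continuous hg).coeFn_toLp]
    with x h1 h2
  rw [h1, h2]
  simp [mul_comm]

theorem radialExt_add (f g : Sphere n → ℝ) :
    radialExt (f + g) = radialExt f + radialExt g := by
  ext y
  by_cases hy : y = 0 <;> simp [radialExt, hy]

theorem radialExt_const_smul (c : ℝ) (f : Sphere n → ℝ) :
    radialExt (c • f) = c • radialExt f := by
  ext y
  by_cases hy : y = 0 <;> simp [radialExt, hy]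

theorem SmoothOnSphere.contDiffAt_radialExt {f : Sphere n → ℝ} (hf : SmoothOnSphere f)
    (x : Sphere n) : ContDiffAt ℝ 2 (radialExt f) (x : EuclideanSpace ℝ (Fin (n + 1))) :=
  (hf.contDiffOn.contDiffAt (isOpen_compl_singleton.mem_nhds (sphere_ne_zero x))).of_le
    (WithTop.coe_le_coe.2 (le_top : (2 : ℕ∞) ≤ ⊤))

theorem IsEigenfunction.add {lam : ℝ≥0} {φ ψ : Sphere n → ℝ} (hφ : IsEigenfunction lam φ)
    (hψ : IsEigenfunction lam ψ) : IsEigenfunction lam (φ + ψ) := by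
  refine ⟨ContMDiff.add hφ.1 hψ.1, fun x => ?_⟩
  have h : sphereLaplacian (φ + ψ) x = sphereLaplacian φ x + sphereLaplacian ψ x := by
    unfold sphereLaplacian
    rw [radialExt_add]
    exact (hφ.1.contDiffAt_radialExt x).laplacian_add (hψ.1.contDiffAt_radialExt x)
  rw [h, Pi.add_apply]
  linear_combination hφ.2 x + hψ.2 x

theorem IsEigenfunction.const_smul {lam : ℝ≥0} {φ : Sphere n → ℝ} (c : ℝ)
    (hφ : IsEigenfunction lam φ) : IsEigenfunction lam (c • φ) := by
  refine ⟨((contDiff_const (c := c)).mul contDiff_id).contMDiff.comp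
    (show ContMDiff (𝓡 n) 𝓘(ℝ, ℝ) ∞ φ from hφ.1), fun x => ?_⟩
  have h : sphereLaplacian (c • φ) x = c * sphereLaplacian φ x := by
    unfold sphereLaplacian
    rw [radialExt_const_smul]
    exact InnerProductSpace.laplacian_smul c (hφ.1.contDiffAt_radialExt x)
  rw [h, Pi.smul_apply, smul_eq_mul]
  linear_combination c * hφ.2 x

theorem IsEigenfunction.continuous {lam : ℝ≥0} {φ : Sphere n → ℝ} (hφ : IsEigenfunction lam φ) :
    Continuous φ :=
  hφ.1.continuous

theorem isEigenfunction_zero (lam : ℝ≥0) : IsEigenfunction lam (0 : Sphere n → ℝ) := by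
  refine ⟨contMDiff_const, fun x => ?_⟩
  have h : radialExt (0 : Sphere n → ℝ) = fun _ => 0 := by
    ext y
    by_cases hy : y = 0 <;> simp [radialExt, hy]
  simp [sphereLaplacian, h]

/-- The span of the eigenfunctions with frequency in `I`. -/
def eigenSpan (n : ℕ) (I : Set ℝ≥0) : Submodule ℝ (L2 n) :=
  Submodule.span ℝ
    {g : L2 n | ∃ lam ∈ I, ∃ φ : Sphere n → ℝ, IsEigenfunction lam φ ∧ g = toL2 φ}

/-- Eigenfunctions of one fixed frequency form a vector space. Hence a duality test on this span
meets only honest eigenfunctions, to which the mode estimates apply. -/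
theorem exists_eq_toL2_of_mem_eigenSpan {lam : ℝ≥0} {w : L2 n} (hw : w ∈ eigenSpan n {lam}) :
    ∃ φ : Sphere n → ℝ, IsEigenfunction lam φ ∧ w = toL2 φ := by
  induction hw using Submodule.span_induction with
  | mem w hw =>
    obtain ⟨_, rfl, φ, hφ, rfl⟩ := hw
    exact ⟨φ, hφ, rfl⟩
  | zero =>
    refine ⟨0, isEigenfunction_zero lam, ?_⟩
    rw [toL2_of_continuous continuous_zero]
    exact (MemLp.toLp_zero _).symm
  | add w z _ _ hw hz =>
    obtain ⟨φ, hφ, rfl⟩ := hw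
    obtain ⟨ψ, hψ, rfl⟩ := hz
    refine ⟨φ + ψ, hφ.add hψ, ?_⟩
    rw [toL2_of_continuous hφ.continuous, toL2_of_continuous hψ.continuous,
      toL2_of_continuous (hφ.add hψ).continuous, ← MemLp.toLp_add]
  | smul c w _ hw =>
    obtain ⟨φ, hφ, rfl⟩ := hw
    refine ⟨c • φ, hφ.const_smul c, ?_⟩
    rw [toL2_of_continuous hφ.continuous, toL2_of_continuous (hφ.const_smul c).continuous,
      ← MemLp.toLp_const_smul]

theorem toL2_mem_eigenSpan {lam : ℝ≥0} {I : Set ℝ≥0} (hI : lam ∈ I) {φ : Sphere n → ℝ}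
    (hφ : IsEigenfunction lam φ) : toL2 φ ∈ eigenSpan n I :=
  Submodule.subset_span ⟨lam, hI, φ, hφ, rfl⟩

theorem eigenSpan_le_spectralSubspace (I : Set ℝ≥0) : eigenSpan n I ≤ spectralSubspace n I :=
  Submodule.le_topologicalClosure _

theorem eigenSpan_mono {I J : Set ℝ≥0} (h : I ⊆ J) : eigenSpan n I ≤ eigenSpan n J :=
  Submodule.span_mono fun _ ⟨lam, hl, φ, hφ, hg⟩ => ⟨lam, h hl, φ, hφ, hg⟩

/-- By symmetry of the Laplacian, eigenfunctions with distinct eigenvalues are orthogonal;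
frequencies are nonnegative, so distinct frequencies have distinct squares. -/
theorem IsEigenfunction.inner_eq_zero {lam μ : ℝ≥0} (hne : lam ≠ μ) {φ ψ : Sphere n → ℝ}
    (hφ : IsEigenfunction lam φ) (hψ : IsEigenfunction μ ψ) :
    inner ℝ (toL2 φ) (toL2 ψ) = 0 := by
  rw [inner_toL2 hφ.continuous hψ.continuous]
  have h1 := hψ.integral_sphereLaplacian_mul hφ.1
  have h2 : ∫ x, sphereLaplacian φ x * ψ x ∂surfaceMeasure n =
      -((lam : ℝ) ^ 2 * ∫ x, φ x * ψ x ∂surfaceMeasure n) := by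
    rw [← integral_const_mul, ← integral_neg]
    congr 1
    ext x
    linear_combination -(ψ x) * hφ.2 x
  have h3 : ((lam : ℝ) ^ 2 - (μ : ℝ) ^ 2) * ∫ x, φ x * ψ x ∂surfaceMeasure n = 0 := by
    linear_combination h2 - h1
  refine (mul_eq_zero.1 h3).resolve_left fun h => hne ?_
  exact NNReal.coe_injective ((sq_eq_sq₀ lam.2 μ.2).1 (sub_eq_zero.1 h))

theorem isOrtho_eigenSpan {I J : Set ℝ≥0} (h : Disjoint I J) :
    eigenSpan n I ⟂ eigenSpan n J := by
  refine Submodule.isOrtho_span.2 ?_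
  rintro _ ⟨lam, hl, φ, hφ, rfl⟩ _ ⟨μ, hμ, ψ, hψ, rfl⟩
  exact hφ.inner_eq_zero (fun e => h.ne_of_mem hl hμ e) hψ

theorem isOrtho_spectralSubspace {I J : Set ℝ≥0} (h : Disjoint I J) :
    spectralSubspace n I ⟂ spectralSubspace n J := by
  have h1 : spectralSubspace n I ≤ (eigenSpan n J)ᗮ :=
    Submodule.topologicalClosure_minimal _ (Submodule.isOrtho_iff_le.1 (isOrtho_eigenSpan h))
      (Submodule.isClosed_orthogonal _)
  have h2 : spectralSubspace n J ≤ (spectralSubspace n I)ᗮ :=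
    Submodule.topologicalClosure_minimal _
      (Submodule.isOrtho_iff_le.1 (Submodule.isOrtho_iff_le.2 h1).symm)
      (Submodule.isClosed_orthogonal _)
  exact (Submodule.isOrtho_iff_le.2 h2).symm

theorem freqProj_singleton_freqProj_of_mem {lam : ℝ≥0} {I : Set ℝ≥0} (h : lam ∈ I) (v : L2 n) :
    freqProj n {lam} (freqProj n I v) = freqProj n {lam} v := by
  have hle : spectralSubspace n {lam} ≤ spectralSubspace n I :=
    Submodule.topologicalClosure_mono (eigenSpan_mono (singleton_subset_iff.2 h))
  exact congrArg (fun T : L2 n →L[ℝ] L2 n => T v)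
    (Submodule.starProjection_comp_starProjection_of_le hle)

theorem freqProj_singleton_freqProj_of_notMem {lam : ℝ≥0} {I : Set ℝ≥0} (h : lam ∉ I)
    (v : L2 n) : freqProj n {lam} (freqProj n I v) = 0 :=
  congrArg (fun T : L2 n →L[ℝ] L2 n => T v)
    (isOrtho_spectralSubspace (disjoint_singleton_left.2 h)).starProjection_comp_starProjection

/-- The norm of a frequency projection is determined by duality with eigenfunctions. -/
theorem norm_freqProj_le {I : Set ℝ≥0} {v : L2 n} {M : ℝ} (hM0 : 0 ≤ M)
    (h : ∀ w ∈ eigenSpan n I, |inner ℝ v w| ≤ M * ‖w‖) : ‖freqProj n I v‖ ≤ M := by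
  have hM : ∀ w ∈ spectralSubspace n I, |inner ℝ v w| ≤ M * ‖w‖ := by
    have hcl : IsClosed {w : L2 n | |inner ℝ v w| ≤ M * ‖w‖} :=
      isClosed_le (by fun_prop) (by fun_prop)
    intro w hw
    exact closure_minimal (s := (eigenSpan n I : Set (L2 n))) h hcl hw
  set p := freqProj n I v with hp
  have h1 : inner ℝ v p = ‖p‖ ^ 2 := by
    have h2 : inner ℝ (v - p) p = (0 : ℝ) :=
      Submodule.starProjection_inner_eq_zero v p (Submodule.starProjection_apply_mem _ v)
    rw [inner_sub_left, real_inner_self_eq_norm_sq] at h2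
    linarith
  have h2 := hM p (Submodule.starProjection_apply_mem _ v)
  rw [h1, abs_of_nonneg (sq_nonneg _)] at h2
  by_contra hlt
  nlinarith [norm_nonneg p]

/-- Projections to high frequencies of a smooth function are small. -/
theorem norm_freqProj_toL2_le {f : Sphere n → ℝ} (hf : SmoothOnSphere f) {I : Set ℝ≥0} {r : ℝ}
    (hr : 0 < r) (hI : ∀ lam ∈ I, r ≤ (lam : ℝ)) :
    ‖freqProj n I (toL2 f)‖ ≤ (r ^ 2)⁻¹ * ‖toL2 (sphereLaplacian f)‖ := by
  refine norm_freqProj_le (by positivity) fun w hw => ?_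
  -- A test vector splits into finitely many components of distinct frequencies, which are mutually
  -- orthogonal, so that Pythagoras applies.
  have hle : eigenSpan n I ≤ ⨆ lam : I, eigenSpan n {lam.1} := by
    refine Submodule.span_le.2 ?_
    rintro _ ⟨lam, hl, φ, hφ, rfl⟩
    exact Submodule.mem_iSup_of_mem (p := fun lam : I => eigenSpan n {lam.1}) ⟨lam, hl⟩
      (toL2_mem_eigenSpan (mem_singleton lam) hφ)
  obtain ⟨c, hc, rfl⟩ := (Submodule.mem_iSup_iff_exists_finsupp _ _).1 (hle hw)
  have hV : OrthogonalFamily ℝ (fun lam : I => eigenSpan n {lam.1})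
      fun lam => (eigenSpan n {lam.1}).subtypeₗᵢ := by
    intro lam μ hne u v
    exact Submodule.isOrtho_iff_inner_eq.1 (isOrtho_eigenSpan (disjoint_singleton.2
      fun h => hne (Subtype.ext h))) u.1 u.2 v.1 v.2
  have hsum : ∀ d : I → ℝ, ‖∑ i ∈ c.support, d i • c i‖ ^ 2 =
      ∑ i ∈ c.support, (d i) ^ 2 * ‖c i‖ ^ 2 := by
    intro d
    have h := hV.norm_sum (fun i => d i • (⟨c i, hc i⟩ : eigenSpan n {i.1})) c.support
    simpa [norm_smul, mul_pow] using h
  -- Green's formula moves the Laplacian to `f` at the price of dividing the component by its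
  -- eigenvalue, which is at least `r²`.
  have hinner : ∀ i, inner ℝ (toL2 f) (c i) =
      -inner ℝ (toL2 (sphereLaplacian f)) ((((i.1 : ℝ)) ^ 2)⁻¹ • c i) := by
    intro i
    obtain ⟨φ, hφ, hcφ⟩ := exists_eq_toL2_of_mem_eigenSpan (hc i)
    have hi : (i.1 : ℝ) ≠ 0 := (hr.trans_le (hI i.1 i.2)).ne'
    rw [inner_smul_right, hcφ, inner_toL2 hf.continuous hφ.continuous,
      inner_toL2 hf.continuous_sphereLaplacian hφ.continuous, hφ.integral_sphereLaplacian_mul hf]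
    field_simp
  have h1 : inner ℝ (toL2 f) (c.sum fun _ v => v) = -inner ℝ (toL2 (sphereLaplacian f))
      (∑ i ∈ c.support, ((i.1 : ℝ) ^ 2)⁻¹ • c i) := by
    rw [Finsupp.sum, inner_sum, inner_sum, ← Finset.sum_neg_distrib]
    exact Finset.sum_congr rfl fun i _ => hinner i
  have h2 : ‖∑ i ∈ c.support, ((i.1 : ℝ) ^ 2)⁻¹ • c i‖ ≤ (r ^ 2)⁻¹ * ‖c.sum fun _ v => v‖ := by
    refine le_of_sq_le_sq ?_ (by positivity)
    have h3 := hsum fun _ => 1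
    simp only [one_smul, one_pow, one_mul] at h3
    rw [hsum, mul_pow, Finsupp.sum, h3, Finset.mul_sum]
    gcongr with i hi
    exact hI i.1 i.2
  rw [h1, abs_neg]
  calc _ ≤ ‖toL2 (sphereLaplacian f)‖ * ‖∑ i ∈ c.support, ((i.1 : ℝ) ^ 2)⁻¹ • c i‖ :=
        abs_real_inner_le_norm _ _
    _ ≤ ‖toL2 (sphereLaplacian f)‖ * ((r ^ 2)⁻¹ * ‖c.sum fun _ v => v‖) := by gcongr
    _ = _ := by ring

/-! ### The multiplier `log ∇` -/

theorem lt_of_mem_band {lam : ℝ≥0} {l m : ℕ} (h : lam ∈ band l) (hm : m < l) : 2 ^ m < lam := by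
  cases l with
  | zero => omega
  | succ l => exact (pow_le_pow_right₀ one_le_two (Nat.lt_succ_iff.1 hm)).trans_lt h.1

theorem le_of_mem_band {lam : ℝ≥0} {l : ℕ} (h : lam ∈ band l) : lam ≤ 2 ^ l := by
  cases l with
  | zero => simpa [band] using h
  | succ l => exact h.2

theorem band_unique {lam : ℝ≥0} {l m : ℕ} (hl : lam ∈ band l) (hm : lam ∈ band m) : l = m := by
  rcases lt_trichotomy l m with h | h | h
  · exact absurd (le_of_mem_band hl) (lt_of_mem_band hm h).not_ge
  · exact h
  · exact absurd (le_of_mem_band hm) (lt_of_mem_band hl h).not_ge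

theorem exists_mem_band (lam : ℝ≥0) : ∃ l, lam ∈ band l := by
  classical
  have hex : ∃ l : ℕ, lam ≤ 2 ^ l := by
    obtain ⟨l, hl⟩ := pow_unbounded_of_one_lt lam one_lt_two
    exact ⟨l, hl.le⟩
  refine ⟨Nat.find hex, ?_⟩
  cases hl : Nat.find hex with
  | zero =>
    have := Nat.find_spec hex
    rw [hl] at this
    simpa [band] using this
  | succ l =>
    have h1 := Nat.find_spec hex
    rw [hl] at h1
    exact ⟨not_le.1 (Nat.find_min hex (by omega)), h1⟩

theorem summable_logGradTerm {f : Sphere n → ℝ} (hf : SmoothOnSphere f) :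
    Summable (logGradTerm (toL2 f)) := by
  -- Band `l + 1` starts at frequency `2 ^ l`, so the decay there is `(1/4) ^ l`; the factor `4`
  -- compensates the shift of the index.
  have hg : Summable fun l : ℕ => 4 * Real.log 2 * ‖toL2 (sphereLaplacian f)‖ *
      ((l : ℝ) ^ 1 * (1 / 4 : ℝ) ^ l) := by
    have hq : ‖(1 / 4 : ℝ)‖ < 1 := by norm_num
    exact Summable.mul_left _ (summable_pow_mul_geometric_of_norm_lt_one (R := ℝ) 1 hq)
  refine Summable.of_norm_bounded hg fun l => ?_
  have hlog : 0 ≤ Real.log 2 := Real.log_nonneg one_le_two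
  rw [logGradTerm, norm_smul, Real.norm_of_nonneg (by positivity)]
  cases l with
  | zero => simp
  | succ l =>
    have h1 := norm_freqProj_toL2_le hf (I := band (l + 1)) (r := 2 ^ l) (by positivity)
      fun lam hlam => by exact_mod_cast hlam.1.le
    have h2 : (((2 : ℝ) ^ l) ^ 2)⁻¹ = (1 / 4) ^ l := by
      rw [← pow_mul, mul_comm, pow_mul, one_div, inv_pow]; norm_num
    rw [h2] at h1
    refine (mul_le_mul_of_nonneg_left h1 (by positivity)).trans_eq ?_
    ring

theorem freqProj_logGrad {v : L2 n} (hv : Summable (logGradTerm v)) {lam : ℝ≥0} {l : ℕ}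
    (hl : lam ∈ band l) :
    freqProj n {lam} (logGrad v) = ((l : ℝ) * Real.log 2) • freqProj n {lam} v := by
  rw [logGrad, ContinuousLinearMap.map_tsum _ hv, tsum_eq_single l]
  · rw [logGradTerm, map_smul, freqProj_singleton_freqProj_of_mem hl]
  · intro m hm
    rw [logGradTerm, map_smul, freqProj_singleton_freqProj_of_notMem
      (fun h => hm (band_unique h hl)), smul_zero]

end ModelScattering

end

noncomputable section

namespace ModelScattering

variable {n : ℕ}

/-! ### Summation over the frequencies -/

/-- A squared bound at each frequency is summed in `ℝ≥0∞`, where no convergence is needed, and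
subadditivity of the square root separates the three norms. -/
theorem sobolevNorm_le_of_forall_freqProj {s s₁ s₂ s₃ K : ℝ} (hK : 0 ≤ K) {v v₁ v₂ v₃ : L2 n}
    (h : ∀ lam : ℝ≥0, (1 + (lam : ℝ) ^ 2) ^ s * ‖freqProj n {lam} v‖ ^ 2 ≤
      K ^ 2 * ((1 + (lam : ℝ) ^ 2) ^ s₁ * ‖freqProj n {lam} v₁‖ ^ 2
        + (1 + (lam : ℝ) ^ 2) ^ s₂ * ‖freqProj n {lam} v₂‖ ^ 2
        + (1 + (lam : ℝ) ^ 2) ^ s₃ * ‖freqProj n {lam} v₃‖ ^ 2)) :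
    sobolevNorm s v ≤
      ENNReal.ofReal K * (sobolevNorm s₁ v₁ + sobolevNorm s₂ v₂ + sobolevNorm s₃ v₃) := by
  have hterm : ∀ (p : ℝ) (z : L2 n), 0 ≤ p →
      ENNReal.ofReal p * ‖z‖ₑ ^ 2 = ENNReal.ofReal (p * ‖z‖ ^ 2) := fun p z hp => by
    rw [ENNReal.ofReal_mul hp, ENNReal.ofReal_pow (norm_nonneg z), ofReal_norm]
  have hp : ∀ (lam : ℝ≥0) (t : ℝ), 0 ≤ (1 + (lam : ℝ) ^ 2) ^ t := fun lam t => by positivity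
  have hsum : ∑' lam : ℝ≥0, ENNReal.ofReal ((1 + (lam : ℝ) ^ 2) ^ s) * ‖freqProj n {lam} v‖ₑ ^ 2 ≤
      ENNReal.ofReal (K ^ 2) *
        ((∑' lam : ℝ≥0, ENNReal.ofReal ((1 + (lam : ℝ) ^ 2) ^ s₁) * ‖freqProj n {lam} v₁‖ₑ ^ 2)
        + (∑' lam : ℝ≥0, ENNReal.ofReal ((1 + (lam : ℝ) ^ 2) ^ s₂) * ‖freqProj n {lam} v₂‖ₑ ^ 2)
        + ∑' lam : ℝ≥0, ENNReal.ofReal ((1 + (lam : ℝ) ^ 2) ^ s₃) *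
          ‖freqProj n {lam} v₃‖ₑ ^ 2) := by
    rw [← ENNReal.tsum_add, ← ENNReal.tsum_add, ← ENNReal.tsum_mul_left]
    refine ENNReal.tsum_le_tsum fun lam => ?_
    rw [hterm _ _ (hp lam s), hterm _ _ (hp lam s₁), hterm _ _ (hp lam s₂),
      hterm _ _ (hp lam s₃), ← ENNReal.ofReal_add (by positivity) (by positivity),
      ← ENNReal.ofReal_add (by positivity) (by positivity), ← ENNReal.ofReal_mul (by positivity)]
    exact ENNReal.ofReal_le_ofReal (h lam)
  have h2 : (0 : ℝ) ≤ 1 / 2 := by norm_num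
  have h3 : (1 / 2 : ℝ) ≤ 1 := by norm_num
  unfold sobolevNorm
  refine (ENNReal.rpow_le_rpow hsum h2).trans ?_
  rw [ENNReal.mul_rpow_of_nonneg _ _ h2]
  have h4 : ENNReal.ofReal (K ^ 2) ^ (1 / 2 : ℝ) = ENNReal.ofReal K := by
    rw [ENNReal.ofReal_rpow_of_nonneg (by positivity) h2, ← Real.sqrt_eq_rpow, Real.sqrt_sq hK]
  rw [h4]
  gcongr
  exact (ENNReal.rpow_add_le_add_rpow _ _ h2 h3).trans
    (add_le_add_left (ENNReal.rpow_add_le_add_rpow _ _ h2 h3) _)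

theorem sq_le_of_le_mul_add {N K a b c : ℝ} (hN : 0 ≤ N) (h : N ≤ K * (a + b + c)) :
    N ^ 2 ≤ (2 * K) ^ 2 * (a ^ 2 + b ^ 2 + c ^ 2) := by
  calc N ^ 2 ≤ (K * (a + b + c)) ^ 2 := by gcongr
    _ = K ^ 2 * (a + b + c) ^ 2 := by ring
    _ ≤ K ^ 2 * (4 * (a ^ 2 + b ^ 2 + c ^ 2)) := by
      gcongr
      nlinarith [sq_nonneg (a - b), sq_nonneg (a - c), sq_nonneg (b - c), sq_nonneg a,
        sq_nonneg b, sq_nonneg c]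
    _ = _ := by ring

/-- On the `l`-th band, including `l = 0`, one has `2 ^ l / 2 ≤ μ ≤ 2 * 2 ^ l`. The logarithms thus
differ by at most `log 2 < 1`. -/
theorem abs_log_sub_le {lam : ℝ≥0} {l : ℕ} (hl : lam ∈ band l) {μ : ℝ} (hμ : 1 ≤ μ)
    (hμl : μ ^ 2 = 1 + (lam : ℝ) ^ 2) : |Real.log μ - l * Real.log 2| ≤ 1 := by
  have hμ0 : 0 < μ := by linarith
  have h2 : Real.log 2 ≤ 1 := by linarith [Real.log_two_lt_d9]
  have h20 : 0 ≤ Real.log 2 := Real.log_nonneg one_le_two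
  have hup : μ ≤ 2 * 2 ^ l := by
    have h1 : (lam : ℝ) ≤ 2 ^ l := by exact_mod_cast le_of_mem_band hl
    have h3 : (1 : ℝ) ≤ 2 ^ l := one_le_pow₀ one_le_two
    nlinarith [lam.2]
  have hlow : (2 : ℝ) ^ l ≤ 2 * μ := by
    cases l with
    | zero => simp; linarith
    | succ l =>
      have h1 : (2 : ℝ) ^ l < lam := by exact_mod_cast hl.1
      have h3 : (lam : ℝ) ≤ μ := by nlinarith [lam.2]
      rw [pow_succ]; linarith
  have hup' := Real.log_le_log hμ0 hup
  have hlow' := Real.log_le_log (by positivity) hlow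
  rw [Real.log_mul two_ne_zero (by positivity), Real.log_pow] at hup'
  rw [Real.log_mul two_ne_zero hμ0.ne', Real.log_pow] at hlow'
  rw [abs_le]
  constructor <;> linarith

variable {q' B : ℝ} {f₁ f₂ f₃ : ℝ → ℝ} {α χ : ℝ → Sphere n → ℝ} {χ₀ O h : Sphere n → ℝ}

theorem abs_inner_le_norm_freqProj {lam : ℝ≥0} {φ : Sphere n → ℝ} (hφ : IsEigenfunction lam φ)
    (v : L2 n) : |inner ℝ v (toL2 φ)| ≤ ‖freqProj n {lam} v‖ * ‖toL2 φ‖ := by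
  have h1 : inner ℝ (v - freqProj n {lam} v) (toL2 φ) = (0 : ℝ) :=
    Submodule.starProjection_inner_eq_zero v _
      (eigenSpan_le_spectralSubspace _ (toL2_mem_eigenSpan (mem_singleton lam) hφ))
  rw [inner_sub_left, sub_eq_zero] at h1
  rw [h1]
  exact abs_real_inner_le_norm _ _

/-- The estimates for the frequency components of a solution. -/
theorem IsSmoothSolution.norm_freqProj_le (hs : IsSmoothSolution q' f₁ f₂ f₃ α χ χ₀ O h)
    (hf : ∀ τ > 0, |f₁ τ| + |f₂ τ| + |f₃ τ| ≤ B) {lam : ℝ≥0} {μ : ℝ} (hμ : 1 ≤ μ)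
    (hμl : μ ^ 2 = 1 + (lam : ℝ) ^ 2) :
    ‖freqProj n {lam} (toL2 O)‖ ≤ 10 * √(modeConst q' B) *
      (√μ * ‖freqProj n {lam} (toL2 (α 1))‖ + (√μ)⁻¹ * ‖freqProj n {lam} (toL2 (timeDeriv α 1))‖
        + (√μ)⁻¹ * ‖freqProj n {lam} (toL2 (χ 1))‖) ∧
    ‖freqProj n {lam} (toL2 h - logGrad (toL2 O))‖ ≤ 10 * √(modeConst q' B) *
      (√μ * ‖freqProj n {lam} (toL2 (α 1))‖ + (√μ)⁻¹ * ‖freqProj n {lam} (toL2 (timeDeriv α 1))‖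
        + (√μ)⁻¹ * ‖freqProj n {lam} (toL2 (χ 1))‖) ∧
    ‖freqProj n {lam} (toL2 χ₀)‖ ≤ (15 * √(modeConst q' B) + 1) *
      (‖freqProj n {lam} (toL2 (α 1))‖ + μ⁻¹ * ‖freqProj n {lam} (toL2 (timeDeriv α 1))‖
        + ‖freqProj n {lam} (toL2 (χ 1))‖) := by
  have hμ0 : 0 < μ := by linarith
  have hB : 0 ≤ B := (abs_le_of_abs_add_le (hf 1 one_pos)).1
  obtain ⟨l, hl⟩ := exists_mem_band lam
  have hlog := abs_log_sub_le hl hμ hμl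
  set N₁ := ‖freqProj n {lam} (toL2 (α 1))‖ with hN₁
  set N₂ := ‖freqProj n {lam} (toL2 (timeDeriv α 1))‖ with hN₂
  set N₃ := ‖freqProj n {lam} (toL2 (χ 1))‖ with hN₃
  set K := √(modeConst q' B) with hK
  have hK0 : 0 ≤ K := Real.sqrt_nonneg _
  have hα : Continuous (α 1) := hs.smooth_alpha.continuous one_pos
  have hα' : Continuous (timeDeriv α 1) := hs.smooth_alpha.timeDeriv.continuous one_pos
  have hχ : Continuous (χ 1) := hs.smooth_chi.continuous one_pos
  -- The scalar estimates for all eigenfunctions of frequency `lam` at once, in the form required by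
  -- the duality bound for the projections.
  have hmode : ∀ w ∈ eigenSpan n {lam},
      |inner ℝ (toL2 O) w| ≤ 5 * K * (√μ * N₁ + (√μ)⁻¹ * N₂ + (√μ)⁻¹ * N₃) * ‖w‖ ∧
      |inner ℝ (toL2 h) w - inner ℝ (toL2 O) w * Real.log μ| ≤
        5 * K * (√μ * N₁ + (√μ)⁻¹ * N₂ + (√μ)⁻¹ * N₃) * ‖w‖ ∧
      |inner ℝ (toL2 χ₀) w| ≤ (15 * K + 1) * (N₁ + μ⁻¹ * N₂ + N₃) * ‖w‖ := by
    intro w hw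
    obtain ⟨φ, hφ, rfl⟩ := exists_eq_toL2_of_mem_eigenSpan hw
    have hφc := hφ.continuous
    have b₁ := abs_inner_le_norm_freqProj hφ (toL2 (α 1))
    have b₂ := abs_inner_le_norm_freqProj hφ (toL2 (timeDeriv α 1))
    have b₃ := abs_inner_le_norm_freqProj hφ (toL2 (χ 1))
    rw [← hN₁, inner_toL2 hα hφc] at b₁
    rw [← hN₂, inner_toL2 hα' hφc] at b₂
    rw [← hN₃, inner_toL2 hχ hφc] at b₃
    rw [inner_toL2 hs.smooth_O.continuous hφc, inner_toL2 hs.smooth_h.continuous hφc,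
      inner_toL2 hs.smooth_chi_zero.continuous hφc]
    obtain ⟨e₁, e₂, e₃⟩ := (hs.isModeSolution hf hφ).asymptotic_data_le hB hμ hμl
      (hs.tendsto_alpha hφc).1 (hs.tendsto_alpha hφc).2 (hs.tendsto_chi hφc)
    set N := ‖toL2 φ‖ with hN
    have c : 5 * K * (√μ * |∫ x, α 1 x * φ x ∂surfaceMeasure n|
        + (√μ)⁻¹ * |∫ x, timeDeriv α 1 x * φ x ∂surfaceMeasure n|
        + (√μ)⁻¹ * |∫ x, χ 1 x * φ x ∂surfaceMeasure n|) ≤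
        5 * K * (√μ * N₁ + (√μ)⁻¹ * N₂ + (√μ)⁻¹ * N₃) * N := by
      calc _ ≤ 5 * K * (√μ * (N₁ * N) + (√μ)⁻¹ * (N₂ * N) + (√μ)⁻¹ * (N₃ * N)) := by gcongr
        _ = _ := by ring
    refine ⟨e₁.trans c, e₂.trans c, e₃.trans ?_⟩
    calc _ ≤ (15 * K + 1) * ((N₁ * N) + μ⁻¹ * (N₂ * N) + (N₃ * N)) := by gcongr
      _ = _ := by ring
  have hnn : 0 ≤ 5 * K * (√μ * N₁ + (√μ)⁻¹ * N₂ + (√μ)⁻¹ * N₃) := by positivity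
  refine ⟨?_, ?_, ?_⟩
  · refine (ModelScattering.norm_freqProj_le hnn fun w hw => (hmode w hw).1).trans ?_
    linarith
  · have hproj : freqProj n {lam} (toL2 h - logGrad (toL2 O)) =
        freqProj n {lam} (toL2 h - ((l : ℝ) * Real.log 2) • toL2 O) := by
      rw [map_sub, map_sub, map_smul, freqProj_logGrad (summable_logGradTerm hs.smooth_O) hl]
    rw [hproj]
    -- Replacing `log μ` by `l log 2` costs one more copy of the bound for `𝒪`, which doubles `5 K`
    -- to `10 K`.
    refine ModelScattering.norm_freqProj_le (by linarith) fun w hw => ?_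
    obtain ⟨e₁, e₂, -⟩ := hmode w hw
    rw [inner_sub_left, real_inner_smul_left]
    have h1 : inner ℝ (toL2 h) w - (l : ℝ) * Real.log 2 * inner ℝ (toL2 O) w =
        (inner ℝ (toL2 h) w - inner ℝ (toL2 O) w * Real.log μ)
        + (Real.log μ - l * Real.log 2) * inner ℝ (toL2 O) w := by ring
    have h2 : |(Real.log μ - l * Real.log 2) * inner ℝ (toL2 O) w| ≤
        1 * |inner ℝ (toL2 O) w| := by
      rw [abs_mul]; gcongr
    rw [h1]
    refine (abs_add_le _ _).trans ?_
    linarith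
  · exact ModelScattering.norm_freqProj_le (by positivity) fun w hw => (hmode w hw).2.2

/-- Since `μ = p ^ (1/2)`, squaring the weights `√μ` and `(√μ)⁻¹` shifts the exponent `s` by `1/2`
up and down. -/
theorem mul_sq_le_of_le_sqrt {p μ s K N N₁ N₂ N₃ : ℝ} (hμ : 0 < μ) (hp : μ = √p) (hp0 : 0 < p)
    (hN : 0 ≤ N) (h : N ≤ K * (√μ * N₁ + (√μ)⁻¹ * N₂ + (√μ)⁻¹ * N₃)) :
    p ^ s * N ^ 2 ≤ (2 * K) ^ 2 *
      (p ^ (s + 1 / 2) * N₁ ^ 2 + p ^ (s - 1 / 2) * N₂ ^ 2 + p ^ (s - 1 / 2) * N₃ ^ 2) := by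
  have h1 := sq_le_of_le_mul_add hN h
  rw [mul_pow (√μ), mul_pow (√μ)⁻¹, mul_pow (√μ)⁻¹, inv_pow, Real.sq_sqrt hμ.le] at h1
  have h2 : p ^ (s + 1 / 2) = p ^ s * μ := by
    rw [Real.rpow_add hp0, hp, Real.sqrt_eq_rpow]
  have h3 : p ^ (s - 1 / 2) = p ^ s * μ⁻¹ := by
    rw [Real.rpow_sub hp0, hp, Real.sqrt_eq_rpow, div_eq_mul_inv]
  rw [h2, h3]
  refine (mul_le_mul_of_nonneg_left h1 (by positivity)).trans_eq ?_
  ring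

/-- The weight `μ⁻¹` squares to `p⁻¹`, lowering the exponent from `s + 1/2` to `s - 1/2`; the
unweighted terms keep `s + 1/2`. -/
theorem mul_sq_le_of_le_inv {p μ s K N N₁ N₂ N₃ : ℝ} (hp : μ = √p) (hp0 : 0 < p)
    (hN : 0 ≤ N) (h : N ≤ K * (N₁ + μ⁻¹ * N₂ + N₃)) :
    p ^ (s + 1 / 2) * N ^ 2 ≤ (2 * K) ^ 2 *
      (p ^ (s + 1 / 2) * N₁ ^ 2 + p ^ (s - 1 / 2) * N₂ ^ 2 + p ^ (s + 1 / 2) * N₃ ^ 2) := by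
  have h1 := sq_le_of_le_mul_add hN h
  rw [mul_pow μ⁻¹, inv_pow, hp, Real.sq_sqrt hp0.le] at h1
  have h3 : p ^ (s - 1 / 2) = p ^ (s + 1 / 2) * p⁻¹ := by
    rw [← Real.rpow_neg_one p, ← Real.rpow_add hp0]
    congr 1
    ring
  rw [h3]
  refine (mul_le_mul_of_nonneg_left h1 (by positivity)).trans_eq ?_
  ring

end ModelScattering

end

/-! ### The main theorem -/

theorem mainTheorem6 (n : ℕ) (hn : 1 ≤ n) (s : ℝ) (hs : 1 ≤ s) (q' : ℝ) (hq' : 1 ≤ q') (B : ℝ) :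
    ∃ C : ℝ≥0, ∀ f₁ f₂ f₃ : ℝ → ℝ, (∀ τ > 0, |f₁ τ| + |f₂ τ| + |f₃ τ| ≤ B) →
      ∀ (α χ : ℝ → ModelScattering.Sphere n → ℝ) (χ₀ O h : ModelScattering.Sphere n → ℝ),
        ModelScattering.IsSmoothSolution q' f₁ f₂ f₃ α χ χ₀ O h →
        Summable (ModelScattering.logGradTerm (ModelScattering.toL2 O)) ∧
        ModelScattering.sobolevNorm s
            (ModelScattering.toL2 h - ModelScattering.logGrad (ModelScattering.toL2 O))
          + ModelScattering.sobolevNorm s (ModelScattering.toL2 O)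
          ≤ C * (ModelScattering.sobolevNorm (s + 1 / 2) (ModelScattering.toL2 (α 1))
            + ModelScattering.sobolevNorm (s - 1 / 2)
                (ModelScattering.toL2 (ModelScattering.timeDeriv α 1))
            + ModelScattering.sobolevNorm (s - 1 / 2) (ModelScattering.toL2 (χ 1))) ∧
        ModelScattering.sobolevNorm (s + 1 / 2) (ModelScattering.toL2 χ₀)
          ≤ C * (ModelScattering.sobolevNorm (s + 1 / 2) (ModelScattering.toL2 (α 1))
            + ModelScattering.sobolevNorm (s - 1 / 2)
                (ModelScattering.toL2 (ModelScattering.timeDeriv α 1))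
            + ModelScattering.sobolevNorm (s + 1 / 2) (ModelScattering.toL2 (χ 1))) := by
  set K := √(ModelScattering.modeConst q' B) with hK
  have hK0 : 0 ≤ K := Real.sqrt_nonneg _
  -- Passing to squares doubles the constants of the frequency estimates. The two norms in the first
  -- inequality contribute `20 K` each, and the second inequality needs `30 K + 2`.
  refine ⟨Real.toNNReal (40 * K + 2), fun f₁ f₂ f₃ hf α χ χ₀ O h hsol => ?_⟩
  have hp0 : ∀ lam : ℝ≥0, 0 < 1 + (lam : ℝ) ^ 2 := fun lam => by positivity
  have hμ : ∀ lam : ℝ≥0, 1 ≤ √(1 + (lam : ℝ) ^ 2) := fun lam =>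
    Real.one_le_sqrt.2 (by linarith [sq_nonneg (lam : ℝ)])
  have hest := fun lam : ℝ≥0 => hsol.norm_freqProj_le hf (hμ lam) (Real.sq_sqrt (hp0 lam).le)
  refine ⟨ModelScattering.summable_logGradTerm hsol.smooth_O, ?_, ?_⟩
  · have h1 := ModelScattering.sobolevNorm_le_of_forall_freqProj (by positivity) fun lam =>
      ModelScattering.mul_sq_le_of_le_sqrt (s := s) (one_pos.trans_le (hμ lam)) rfl (hp0 lam)
        (norm_nonneg _) (hest lam).2.1
    have h2 := ModelScattering.sobolevNorm_le_of_forall_freqProj (by positivity) fun lam =>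
      ModelScattering.mul_sq_le_of_le_sqrt (s := s) (one_pos.trans_le (hμ lam)) rfl (hp0 lam)
        (norm_nonneg _) (hest lam).1
    refine (add_le_add h1 h2).trans ?_
    rw [← add_mul, ← ENNReal.ofReal_add (by positivity) (by positivity)]
    refine mul_le_mul_left (ENNReal.ofReal_le_ofReal ?_) _
    linarith
  · have h1 := ModelScattering.sobolevNorm_le_of_forall_freqProj (by positivity) fun lam =>
      ModelScattering.mul_sq_le_of_le_inv (s := s) rfl (hp0 lam) (norm_nonneg _) (hest lam).2.2
    refine h1.trans (mul_le_mul_left (ENNReal.ofReal_le_ofReal ?_) _)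
    linarith
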